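/- **Theorem 1.** Assume the Generalized Riemann Hypothesis: for every Dirichlet character $\chi$, every zero of $L(s,\chi)$ with $0<\Re s<1$ satisfies $\Re s=\tfrac12$. For complex $\alpha,\gamma$ put $$I_{\alpha,\gamma}(n)=\sum_{de=n}\frac{\mu(e)}{d^{\alpha}e^{\gamma}},\qquad e(x)=e^{2\pi i x},\qquad r_q(h)=\sum_{\substack{0\le a<q\\ (a,q)=1}}e(ah/q),$$ and let $\chi(s)=2^s\pi^{s-1}\sin(\pi s/2)\Gamma(1-s)$ be the factor in the functional equation $\zeta(s)=\chi(s)\zeta(1-s)$. Let $\mathcal B_{a,b,c,d}(z)=\sum_{n\ge1}I_{a,c}(n)I_{b,d}(n)n^{-z}$ be the Rankin–Selberg series; it and the series $\sum_{m}I_{\alpha,\gamma}(m)e(m/q)m^{-w}$ are understood through their meromorphic continuations from a half-plane of absolute convergence (in $z$, respectively $w$). Let $\alpha,\beta,\gamma,\delta\in\mathbb C$ and let $\epsilon<\tfrac12$ be larger than $|\alpha|,|\beta|,|\gamma|,|\delta|$ and such that $1-\epsilon+\Re\gamma>\tfrac12$ and $1-\epsilon+\Re\delta>\tfrac12$. For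 $\Re s>1+2\epsilon$ define $$\mathcal C_{\alpha,\beta,\gamma,\delta}(s)=\sum_{q=1}^\infty\frac1{(2\pi i)^2}\int_{|w-1|=\epsilon}\int_{|z-1|=\epsilon}\chi(w+z-s-1)\sum_{h=1}^\infty\frac{r_q(h)}{h^{s+2-w-z}}\sum_{m=1}^\infty\frac{I_{\alpha,\gamma}(m)e(m/q)}{m^w}\sum_{n=1}^\infty\frac{I_{\beta,\delta}(n)e(n/q)}{n^z}\,dz\,dw .$$ Then, for every such $s$, the series over $h$ converge absolutely on the contours, the continued series over $m$ and $n$ are regular on the contours, the continuation of $\mathcal B_{-\beta,-\alpha-s,\gamma+s,\delta}(z)$ is regular at $z=1$, the series over $q$ converges absolutely, and $$\mathcal C_{\alpha,\beta,\gamma,\delta}(s)=\mathcal B_{-\beta,-\alpha-s,\gamma+s,\delta}(1).$$ -/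

import Mathlib

open Complex Metric

noncomputable section

/-- The Generalized Riemann Hypothesis: every zero in the open critical strip of the Dirichlet
`L`-function of a Dirichlet character (of any modulus; modulus one is the Riemann zeta function)
lies on the line `Re s = 1 / 2`. -/
def GeneralizedRiemannHypothesis : Prop :=
  ∀ (N : ℕ) [NeZero N] (χ : DirichletCharacter ℂ N) (s : ℂ),
    DirichletCharacter.LFunction χ s = 0 → 0 < s.re → s.re < 1 → s.re = 1 / 2

/-- The additive character `e(x) = exp(2πix)`. -/
def additiveChar (x : ℝ) : ℂ := Complex.exp (2 * Real.pi * I * x)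

/-- The arithmetic function `I_{α,γ}(n) = ∑_{de = n} μ(e) d^{-α} e^{-γ}`. -/
def ratioCoeff (α γ : ℂ) (n : ℕ) : ℂ :=
  ∑ p ∈ n.divisorsAntidiagonal,
    (ArithmeticFunction.moebius p.2 : ℂ) * (p.1 : ℂ) ^ (-α) * (p.2 : ℂ) ^ (-γ)

/-- Ramanujan's sum `r_q(h)`: the sum of `e(ah/q)` over the reduced residues `a` modulo `q`. -/
def ramanujanSum (q h : ℕ) : ℂ :=
  ∑ a ∈ (Finset.range q).filter (fun a => Nat.Coprime a q),
    additiveChar ((a : ℝ) * (h : ℝ) / (q : ℝ))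

/-- The factor `χ(s) = 2^s π^{s-1} sin(πs/2) Γ(1-s)` of the functional equation
`ζ(s) = χ(s) ζ(1-s)`. -/
def zetaChi (s : ℂ) : ℂ :=
  (2 : ℂ) ^ s * (Real.pi : ℂ) ^ (s - 1) * Complex.sin (Real.pi * s / 2) * Complex.Gamma (1 - s)

/-- `F` continues the Dirichlet series `∑ f(n) n^{-z}` meromorphically from a half-plane of
absolute convergence to a half-plane containing `z`, and is regular at `z`. -/
def ContinuesTo (f : ℕ → ℂ) (z : ℂ) (F : ℂ → ℂ) : Prop :=
  AnalyticAt ℂ F z ∧ ∃ c : ℝ, c < z.re ∧ MeromorphicOn F {w : ℂ | c < w.re} ∧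
    ∃ x : ℝ, ∀ w : ℂ, x < w.re → LSeriesSummable f w ∧ F w = LSeries f w

/-- The Dirichlet series of `f` has a meromorphic continuation, as above, regular at `z`. -/
def IsRegularAt (f : ℕ → ℂ) (z : ℂ) : Prop := ∃ F : ℂ → ℂ, ContinuesTo f z F

open Classical in
/-- The value at `z` of the meromorphic continuation of `∑ f(n) n^{-z}` (zero if there is no
continuation regular at `z`); by `dirichletValue_eq` it does not depend on choices. -/
def dirichletValue (f : ℕ → ℂ) (z : ℂ) : ℂ :=
  if h : IsRegularAt f z then h.choose z else 0

theorem ContinuesTo.unique {f : ℕ → ℂ} {z : ℂ} {F G : ℂ → ℂ}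
    (hF : ContinuesTo f z F) (hG : ContinuesTo f z G) : F z = G z := by
  obtain ⟨hFa, c, hc, hFm, x, hx⟩ := hF
  obtain ⟨hGa, d, hd, hGm, y, hy⟩ := hG
  set U : Set ℂ := {w : ℂ | max c d < w.re} with hU
  have hHm : MeromorphicOn (F - G) U := fun w hw =>
    (hFm w (lt_of_le_of_lt (le_max_left c d) hw)).sub
      (hGm w (lt_of_le_of_lt (le_max_right c d) hw))
  have hzU : z ∈ U := max_lt hc hd
  have hUc : IsPreconnected U := (convex_halfSpace_re_gt (max c d)).isPreconnected
  set b : ℝ := max (max c d) (max x y) + 1 with hb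
  have hbU : (b : ℂ) ∈ U := by
    have := le_max_left (max c d) (max x y)
    simp only [hU, Set.mem_ofPred_eq, Complex.ofReal_re]
    linarith
  have hloc : ∀ᶠ w in nhds (b : ℂ), (F - G) w = 0 := by
    have hopen : IsOpen {w : ℂ | max x y < w.re} := isOpen_lt continuous_const continuous_re
    have hmem : (b : ℂ) ∈ {w : ℂ | max x y < w.re} := by
      have := le_max_right (max c d) (max x y)
      simp only [Set.mem_ofPred_eq, Complex.ofReal_re]
      linarith
    filter_upwards [hopen.mem_nhds hmem] with w hw
    have h1 := (hx w (lt_of_le_of_lt (le_max_left x y) hw)).2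
    have h2 := (hy w (lt_of_le_of_lt (le_max_right x y) hw)).2
    simp [h1, h2]
  have hbtop : meromorphicOrderAt (F - G) (b : ℂ) = ⊤ :=
    meromorphicOrderAt_eq_top_iff.mpr (hloc.filter_mono nhdsWithin_le_nhds)
  have hztop : meromorphicOrderAt (F - G) z = ⊤ := by
    by_contra hne
    exact hHm.meromorphicOrderAt_ne_top_of_isPreconnected hUc hzU hbU hne hbtop
  have hev := meromorphicOrderAt_eq_top_iff.mp hztop
  have hcont : Filter.Tendsto (F - G) (nhdsWithin z {z}ᶜ) (nhds ((F - G) z)) :=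
    (hFa.sub hGa).continuousAt.tendsto.mono_left nhdsWithin_le_nhds
  have hzero : Filter.Tendsto (F - G) (nhdsWithin z {z}ᶜ) (nhds 0) :=
    tendsto_const_nhds.congr' (hev.mono fun w hw => hw.symm)
  have := tendsto_nhds_unique hcont hzero
  exact sub_eq_zero.mp this

theorem dirichletValue_eq {f : ℕ → ℂ} {z : ℂ} {F : ℂ → ℂ} (hF : ContinuesTo f z F) :
    dirichletValue f z = F z := by
  have h : IsRegularAt f z := ⟨F, hF⟩
  rw [dirichletValue, dif_pos h]
  exact h.choose_spec.unique hF

/-- Coefficients of the additively twisted series `∑_m I_{α,γ}(m) e(m/q) m^{-w}`. -/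
def twistedCoeff (α γ : ℂ) (q m : ℕ) : ℂ :=
  ratioCoeff α γ m * additiveChar ((m : ℝ) / (q : ℝ))

/-- The Rankin–Selberg series `𝓑_{a,b,c,d}(z) = ∑_n I_{a,c}(n) I_{b,d}(n) n^{-z}`, by
meromorphic continuation in `z`. -/
def rankinSelberg (a b c d z : ℂ) : ℂ :=
  dirichletValue (fun n => ratioCoeff a c n * ratioCoeff b d n) z

/-- The contribution of the modulus `q` to the double contour integral `𝓒_{α,β,γ,δ}(s)`. -/
def contourTerm (α β γ δ : ℂ) (ε : ℝ) (s : ℂ) (q : ℕ) : ℂ :=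
  1 / (2 * Real.pi * I) ^ 2 *
    ∮ w in C(1, ε), ∮ z in C(1, ε),
      zetaChi (w + z - s - 1) * LSeries (ramanujanSum q) (s + 2 - w - z) *
        dirichletValue (twistedCoeff α γ q) w * dirichletValue (twistedCoeff β δ q) z

end

/-! Each modulus `q` contributes a product of two residues, and the sum over `q` of these
contributions is an Euler product.

Write `m = de` in the twisted series for `I_{α,γ}`. Since `e(de/q)` depends on `e` only modulo `q`,
the series splits over the classes `a = e mod q` into a periodic zeta function in `w + α` times a
Möbius series over the class in `w + γ`. Under GRH the Möbius series continue to `Re > 1/2`, by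
characters. The periodic zeta function is entire unless `a = 0`, when it is `ζ(w + α)`. Hence the
only possible pole on or inside the circle is `w = 1 - α`, with residue `μ(q) q^{-(1-α+γ)} /
L(1-α+γ, χ₀ mod q)` (`exists_twisted_continuation`). The remaining factor of the integrand is
holomorphic and depends only on `w + z`, so two applications of Cauchy's formula evaluate the double
integral (`contourTerm_eq_residue`).

Put `u = s + α + β`. At the poles, the series over `h` is `ζ(u) ∑_{d ∣ q} μ(d) (q/d)^{1-u}`, and the
functional equation turns `χ(1-u) ζ(u)` into `ζ(1-u)`. The factors `μ(q)` from the residues restrict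
`q` to squarefree integers, where everything factors over primes. With `X = p^{-(1-β+δ)}` and `Y =
p^{-(1-α+γ)}` the local factor is `(p^{1-u} - 1) XY / ((1-X)(1-Y))`.

On the other side, the Euler factor of `𝓑_{a,b,c,d}(z)` divided by those of `ζ(z+a+b) / (ζ(z+a+d)
ζ(z+b+c))` is `1 + (W - XY) / ((1-X)(1-Y))`, with `X`, `Y`, `W` the powers `p^{-(z+a+d)}`,
`p^{-(z+b+c)}`, `p^{-(z+c+d)}`. At the parameters of the theorem `W = p^{1-u} XY`, so the two agree
(`mul_twistedResidue_eq_squarefreeProd`). The expanded product converges absolutely well beyond the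
original half-plane, and so supplies the continuation (`continuesTo_rankinSelberg`) together with
the convergence over `q`. -/

/-! ### Reciprocals of Dirichlet `L`-functions under GRH. -/

/-- The entire function `(s - 1) L(s, χ₀)` attached to the trivial character modulo `N`. -/
noncomputable def trivLEntire (N : ℕ) [NeZero N] (s : ℂ) : ℂ :=
  DirichletCharacter.LFunctionTrivChar₁ N s

/-- The continuation of `1 / L(s, χ₀)` for the trivial character modulo `N`; it vanishes
at `s = 1`. -/
noncomputable def trivLInv (N : ℕ) [NeZero N] (s : ℂ) : ℂ := (s - 1) / trivLEntire N s

theorem trivLEntire_of_ne (N : ℕ) [NeZero N] {s : ℂ} (hs : s ≠ 1) :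
    trivLEntire N s = (s - 1) * DirichletCharacter.LFunctionTrivChar N s := by
  simp [trivLEntire, Function.update_of_ne hs]

theorem differentiable_trivLEntire (N : ℕ) [NeZero N] : Differentiable ℂ (trivLEntire N) :=
  DirichletCharacter.differentiable_LFunctionTrivChar₁ N

theorem trivLEntire_one_one : trivLEntire 1 1 = 1 := by
  simp [trivLEntire]

theorem trivLEntire_one_of_ne {s : ℂ} (hs : s ≠ 1) :
    trivLEntire 1 s = (s - 1) * riemannZeta s := by
  rw [trivLEntire_of_ne 1 hs, DirichletCharacter.LFunctionTrivChar,
    DirichletCharacter.LFunction_modOne_eq]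

theorem trivLInv_of_ne (N : ℕ) [NeZero N] {s : ℂ} (hs : s ≠ 1) :
    trivLInv N s = (DirichletCharacter.LFunctionTrivChar N s)⁻¹ := by
  have : s - 1 ≠ 0 := sub_ne_zero.mpr hs
  rw [trivLInv, trivLEntire_of_ne N hs, div_mul_cancel_left₀ this]

/-- Isolates the dependence of the residues on the modulus: a finite product over primes dividing
`N`. At `s = 1` both sides vanish. -/
theorem trivLInv_eq_prod (N : ℕ) [NeZero N] (s : ℂ) :
    trivLInv N s = trivLInv 1 s * ∏ p ∈ N.primeFactors, (1 - (p : ℂ) ^ (-s))⁻¹ := by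
  rcases eq_or_ne s 1 with rfl | hs
  · simp [trivLInv]
  · rw [trivLInv_of_ne N hs, trivLInv_of_ne 1 hs,
      DirichletCharacter.LFunctionTrivChar_eq_mul_riemannZeta hs,
      DirichletCharacter.LFunctionTrivChar,
    DirichletCharacter.LFunction_modOne_eq, mul_inv, Finset.prod_inv_distrib, mul_comm]

theorem GeneralizedRiemannHypothesis.lFunction_ne_zero (hGRH : GeneralizedRiemannHypothesis)
    {N : ℕ} [NeZero N] (χ : DirichletCharacter ℂ N) {s : ℂ} (hs : 1 / 2 < s.re)
    (h : χ ≠ 1 ∨ s ≠ 1) : DirichletCharacter.LFunction χ s ≠ 0 := by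
  rcases le_or_gt 1 s.re with h1 | h1
  · exact DirichletCharacter.LFunction_ne_zero_of_one_le_re χ h h1
  · intro h0
    have := hGRH N χ s h0 (by linarith) h1
    linarith

theorem GeneralizedRiemannHypothesis.trivLEntire_ne_zero (hGRH : GeneralizedRiemannHypothesis)
    (N : ℕ) [NeZero N] {s : ℂ} (hs : 1 / 2 < s.re) : trivLEntire N s ≠ 0 := by
  rcases eq_or_ne s 1 with rfl | h1
  · exact DirichletCharacter.LFunctionTrivChar₁_apply_one_ne_zero N
  · rw [trivLEntire_of_ne N h1]
    exact mul_ne_zero (sub_ne_zero.mpr h1) (hGRH.lFunction_ne_zero 1 hs (.inr h1))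

theorem GeneralizedRiemannHypothesis.differentiableOn_trivLInv
    (hGRH : GeneralizedRiemannHypothesis) (N : ℕ) [NeZero N] :
    DifferentiableOn ℂ (trivLInv N) {s | 1 / 2 < s.re} := fun s hs =>
  ((differentiableAt_id.sub_const 1).div (differentiable_trivLEntire N s)
    (hGRH.trivLEntire_ne_zero N hs)).differentiableWithinAt

theorem lSeriesHasSum_char_mul_moebius {N : ℕ} (χ : DirichletCharacter ℂ N) {s : ℂ}
    (hs : 1 < s.re) :
    LSeriesHasSum (fun n : ℕ => χ n * (ArithmeticFunction.moebius n : ℂ)) s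
      (LSeries (fun n : ℕ => χ n) s)⁻¹ := by
  have h1 := DirichletCharacter.LSeries.mul_mu_eq_one χ hs
  have h2 := DirichletCharacter.LSeriesSummable_mul χ
    (ArithmeticFunction.LSeriesSummable_moebius_iff.mpr hs)
  have h3 := h2.LSeriesHasSum
  rwa [← inv_eq_of_mul_eq_one_right h1] at h3

theorem lSeriesHasSum_triv_mul_moebius (N : ℕ) [NeZero N] {s : ℂ} (hs : 1 < s.re) :
    LSeriesHasSum (fun n : ℕ => (1 : DirichletCharacter ℂ N) n *
      (ArithmeticFunction.moebius n : ℂ)) s (trivLInv N s) := by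
  have h := lSeriesHasSum_char_mul_moebius (1 : DirichletCharacter ℂ N) hs
  rwa [← DirichletCharacter.LFunction_eq_LSeries _ hs,
    ← trivLInv_of_ne N (by rintro rfl; simp at hs)] at h

/-! ### Möbius series in residue classes. -/

/-- The Dirichlet series of `f` converges absolutely for `Re s > 1` and continues analytically
to `Re s > 1 / 2`. -/
def ContinuesToHalf (f : ℕ → ℂ) : Prop :=
  ∃ M : ℂ → ℂ, DifferentiableOn ℂ M {s | 1 / 2 < s.re} ∧ ∀ s : ℂ, 1 < s.re → LSeriesHasSum f s (M s)

theorem ContinuesToHalf.sum {ι : Type*} (S : Finset ι) {f : ι → ℕ → ℂ}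
    (h : ∀ i ∈ S, ContinuesToHalf (f i)) : ContinuesToHalf (∑ i ∈ S, f i) := by
  choose! M hM hs using h
  exact ⟨fun s => ∑ i ∈ S, M i s, .fun_sum fun i hi => hM i hi,
    fun s h1 => .sum fun i hi => hs i hi s h1⟩

theorem ContinuesToHalf.smul {f : ℕ → ℂ} (c : ℂ) (h : ContinuesToHalf f) :
    ContinuesToHalf (c • f) := by
  obtain ⟨M, hM, hs⟩ := h
  exact ⟨fun s => c * M s, hM.const_mul c, fun s h1 => (hs s h1).smul c⟩

theorem lSeriesHasSum_dilate {f : ℕ → ℂ} {s a : ℂ} {g : ℕ} (hg : g ≠ 0)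
    (h : LSeriesHasSum f s a) :
    LSeriesHasSum (fun n => if g ∣ n then f (n / g) else 0) s ((g : ℂ) ^ (-s) * a) := by
  have hinj : Function.Injective (fun m : ℕ => g * m) := mul_right_injective₀ hg
  rw [LSeriesHasSum, ← hinj.hasSum_iff]
  · refine (HasSum.mul_left ((g : ℂ) ^ (-s)) h).congr_fun fun m => ?_
    rcases eq_or_ne m 0 with rfl | hm
    · simp
    · have hgm : g * m ≠ 0 := mul_ne_zero hg hm
      simp only [Function.comp, LSeries.term_of_ne_zero hgm, LSeries.term_of_ne_zero hm,
        dvd_mul_right, if_true, Nat.mul_div_cancel_left m (Nat.pos_of_ne_zero hg)]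
      rw [Nat.cast_mul, natCast_mul_natCast_cpow, cpow_neg]
      field_simp
  · intro n hn
    have : ¬ g ∣ n := fun ⟨m, hm⟩ => hn ⟨m, hm.symm⟩
    simp [LSeries.term, this]

theorem ContinuesToHalf.dilate {f : ℕ → ℂ} {g : ℕ} (hg : g ≠ 0) (h : ContinuesToHalf f) :
    ContinuesToHalf (fun n => if g ∣ n then f (n / g) else 0) := by
  obtain ⟨M, hM, hs⟩ := h
  refine ⟨fun s => (g : ℂ) ^ (-s) * M s, DifferentiableOn.mul (fun s _ => ?_) hM,
    fun s h1 => lSeriesHasSum_dilate hg (hs s h1)⟩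
  exact (differentiableAt_neg_iff.mpr differentiableAt_id).const_cpow
    (.inl (Nat.cast_ne_zero.mpr hg)) |>.differentiableWithinAt

theorem GeneralizedRiemannHypothesis.continuesToHalf_char_mul_moebius
    (hGRH : GeneralizedRiemannHypothesis) {N : ℕ} [NeZero N] (χ : DirichletCharacter ℂ N) :
    ContinuesToHalf (fun n : ℕ => χ n * (ArithmeticFunction.moebius n : ℂ)) := by
  by_cases hχ : χ = 1
  · subst hχ
    exact ⟨trivLInv N, hGRH.differentiableOn_trivLInv N,
      fun s hs => lSeriesHasSum_triv_mul_moebius N hs⟩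
  · refine ⟨fun s => (DirichletCharacter.LFunction χ s)⁻¹, fun s hs => ?_, fun s hs => ?_⟩
    · exact ((DirichletCharacter.differentiable_LFunction hχ s).inv
        (hGRH.lFunction_ne_zero χ hs (.inl hχ))).differentiableWithinAt
    · dsimp only
      rw [DirichletCharacter.LFunction_eq_LSeries χ hs]
      exact lSeriesHasSum_char_mul_moebius χ hs

open Classical in
-- Orthogonality of characters: the coefficients are the Fourier coefficients of `h` on the unit
-- group.
theorem exists_sum_char_eq {N : ℕ} [NeZero N] (h : ZMod N → ℂ) :
    ∃ c : DirichletCharacter ℂ N → ℂ, ∀ b : ZMod N,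
      ∑ χ, c χ * χ b = if IsUnit b then h b else 0 := by
  refine ⟨fun χ => (N.totient : ℂ)⁻¹ * ∑ a : (ZMod N)ˣ, h a * χ (a : ZMod N)⁻¹, fun b => ?_⟩
  have hN : (N.totient : ℂ) ≠ 0 :=
    Nat.cast_ne_zero.mpr (Nat.totient_pos.mpr (Nat.pos_of_ne_zero (NeZero.ne N))).ne'
  have : ∀ χ : DirichletCharacter ℂ N,
      (N.totient : ℂ)⁻¹ * (∑ a : (ZMod N)ˣ, h a * χ (a : ZMod N)⁻¹) * χ b =
      ∑ a : (ZMod N)ˣ, (N.totient : ℂ)⁻¹ * h a * (χ (a : ZMod N)⁻¹ * χ b) := fun χ => by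
    rw [Finset.mul_sum, Finset.sum_mul]
    exact Finset.sum_congr rfl fun a _ => by ring
  simp_rw [this]
  rw [Finset.sum_comm]
  simp_rw [← Finset.mul_sum, DirichletCharacter.sum_char_inv_mul_char_eq ℂ (Units.isUnit _)]
  split_ifs with hb
  · obtain ⟨u, rfl⟩ := hb
    rw [Finset.sum_eq_single u]
    · simp only [if_true]; field_simp
    · intro v _ hv
      rw [if_neg (fun h => hv (Units.ext h)), mul_zero]
    · simp
  · refine Finset.sum_eq_zero fun a _ => ?_
    rw [if_neg, mul_zero]
    rintro rfl
    exact hb a.isUnit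

open Classical in
theorem GeneralizedRiemannHypothesis.continuesToHalf_unit_mul_moebius
    (hGRH : GeneralizedRiemannHypothesis) {N : ℕ} [NeZero N] (h : ZMod N → ℂ) :
    ContinuesToHalf (fun n : ℕ => (if IsUnit (n : ZMod N) then h n else 0) *
      (ArithmeticFunction.moebius n : ℂ)) := by
  obtain ⟨c, hc⟩ := exists_sum_char_eq h
  convert ContinuesToHalf.sum Finset.univ fun χ _ =>
    (hGRH.continuesToHalf_char_mul_moebius χ).smul (c χ) using 1
  ext n
  rw [← hc n, Finset.sum_apply, Finset.sum_mul]
  exact Finset.sum_congr rfl fun χ _ => by simp [mul_assoc]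

/-- The condition `gcd(gm, q) = g` only forces `m` to be coprime to `q / g`. If `m` also shares a
factor with `g`, then `gm` is not squarefree and `μ(gm) = 0`, so coprimality to all of `q` may be
imposed. -/
theorem moebius_mul_of_gcd {q g m : ℕ} (hq : q ≠ 0) (hg : g ∣ q) :
    (if (g * m).gcd q = g then ArithmeticFunction.moebius (g * m) else 0) =
      if m.Coprime q then ArithmeticFunction.moebius g * ArithmeticFunction.moebius m else 0 := by
  by_cases hm : m.Coprime q
  · have h1 : (g * m).gcd q = g := by
      rw [Nat.Coprime.gcd_mul_right_cancel g hm, Nat.gcd_eq_left hg]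
    rw [if_pos h1, if_pos hm, ArithmeticFunction.isMultiplicative_moebius.map_mul_of_coprime
      (hm.coprime_dvd_right hg).symm]
  · rw [if_neg hm]
    split_ifs with h
    · by_cases hc : m.Coprime g
      · obtain ⟨k, rfl⟩ := hg
        have hg0 : 0 < g := Nat.pos_of_ne_zero (left_ne_zero_of_mul hq)
        rw [Nat.gcd_mul_left] at h
        have : m.gcd k = 1 := Nat.eq_of_mul_eq_mul_left hg0 (by rw [h, mul_one])
        exact absurd (Nat.Coprime.mul_right hc this) hm
      · rw [ArithmeticFunction.moebius_eq_zero_of_not_squarefree]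
        intro hs
        exact hc (Nat.coprime_of_squarefree_mul hs).symm
    · rfl

/-- Characters see only classes prime to `q`, so the integers are sorted by `g = gcd(n, q)`. With `n
= gm` each piece becomes a dilate of a Möbius series over units modulo `q`. -/
theorem GeneralizedRiemannHypothesis.continuesToHalf_residueClass_moebius
    (hGRH : GeneralizedRiemannHypothesis) {q : ℕ} [NeZero q] (f : ZMod q → ℂ) :
    ContinuesToHalf (fun n : ℕ => f n * (ArithmeticFunction.moebius n : ℂ)) := by
  classical
  have hq : q ≠ 0 := NeZero.ne q
  convert ContinuesToHalf.sum q.divisors fun g hg =>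
    ((hGRH.continuesToHalf_unit_mul_moebius (N := q) fun b => f ((g : ZMod q) * b)).smul
      (ArithmeticFunction.moebius g : ℂ)).dilate (Nat.pos_of_mem_divisors hg).ne' using 1
  ext n
  rw [Finset.sum_apply]
  have key : ∀ g ∈ q.divisors,
      (if g ∣ n then ((ArithmeticFunction.moebius g : ℂ) • fun n : ℕ =>
        (if IsUnit (n : ZMod q) then f ((g : ZMod q) * n) else 0) *
          (ArithmeticFunction.moebius n : ℂ)) (n / g) else 0) =
      if n.gcd q = g then f n * (ArithmeticFunction.moebius n : ℂ) else 0 := by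
    intro g hg
    by_cases hgn : g ∣ n
    · obtain ⟨m, rfl⟩ := hgn
      have hg0 := Nat.pos_of_mem_divisors hg
      have h := moebius_mul_of_gcd (m := m) hq (Nat.dvd_of_mem_divisors hg)
      rw [if_pos (dvd_mul_right g m), Nat.mul_div_cancel_left m hg0]
      simp only [Pi.smul_apply, smul_eq_mul, ZMod.isUnit_iff_coprime]
      have hite : (if (g * m).gcd q = g then
          f ((g * m : ℕ) : ZMod q) * (ArithmeticFunction.moebius (g * m) : ℂ) else 0) =
          f ((g * m : ℕ) : ZMod q) * ((if (g * m).gcd q = g then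
            ArithmeticFunction.moebius (g * m) else 0 : ℤ) : ℂ) := by
        split_ifs <;> simp
      rw [hite, h]
      split_ifs
      · push_cast; ring
      · simp
    · rw [if_neg hgn, if_neg]
      rintro rfl
      exact hgn (Nat.gcd_dvd_left n q)
  rw [Finset.sum_congr rfl key, Finset.sum_ite_eq,
    if_pos (Nat.mem_divisors.mpr ⟨Nat.gcd_dvd_right n q, hq⟩)]

/-- The zero class needs an explicit formula, as it alone produces the pole of the twisted series.
Only `n = qm` with `m` prime to `q` survive. -/
theorem lSeriesHasSum_dvd_moebius (q : ℕ) [NeZero q] {s : ℂ} (hs : 1 < s.re) :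
    LSeriesHasSum (fun n : ℕ => if q ∣ n then (ArithmeticFunction.moebius n : ℂ) else 0) s
      ((ArithmeticFunction.moebius q : ℂ) * (q : ℂ) ^ (-s) * trivLInv q s) := by
  have hq : q ≠ 0 := NeZero.ne q
  have h := lSeriesHasSum_dilate hq
    ((lSeriesHasSum_triv_mul_moebius q hs).smul (ArithmeticFunction.moebius q : ℂ))
  rw [mul_left_comm, ← mul_assoc] at h
  refine (LSeriesHasSum_congr _ _ fun {n} _ => ?_).mp h
  by_cases hn : q ∣ n
  · obtain ⟨m, rfl⟩ := hn
    have h := moebius_mul_of_gcd (m := m) hq dvd_rfl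
    rw [if_pos (by simp)] at h
    simp only [dvd_mul_right, if_true, Nat.mul_div_cancel_left m (Nat.pos_of_ne_zero hq), h]
    by_cases hm : m.Coprime q
    · simp [hm, MulChar.one_apply ((ZMod.isUnit_iff_coprime m q).mpr hm)]
    · simp [hm, MulChar.map_nonunit _ (mt (ZMod.isUnit_iff_coprime m q).mp hm)]
  · simp [hn]

/-! ### Continuation of the additively twisted series. -/

theorem additiveChar_add (x y : ℝ) : additiveChar (x + y) = additiveChar x * additiveChar y := by
  simp only [additiveChar, ← Complex.exp_add]
  congr 1
  push_cast
  ring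

theorem additiveChar_natCast (n : ℕ) : additiveChar n = 1 := by
  rw [additiveChar, ofReal_natCast, mul_comm]
  exact Complex.exp_nat_mul_two_pi_mul_I n

theorem additiveChar_natCast_div_congr {q : ℕ} (hq : q ≠ 0) {m n : ℕ} (h : m ≡ n [MOD q]) :
    additiveChar ((m : ℝ) / q) = additiveChar ((n : ℝ) / q) := by
  have hq' : (q : ℝ) ≠ 0 := Nat.cast_ne_zero.mpr hq
  have key : ∀ k : ℕ, additiveChar ((k : ℝ) / q) = additiveChar (((k % q : ℕ) : ℝ) / q) := by
    intro k
    have : (k : ℝ) / q = ((k % q : ℕ) : ℝ) / q + ((k / q : ℕ) : ℝ) := by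
      field_simp
      exact_mod_cast (Nat.mod_add_div k q).symm
    rw [this, additiveChar_add, additiveChar_natCast, mul_one]
  rw [key m, key n, h]

theorem LSeriesHasSum.mul_cpow_neg {f : ℕ → ℂ} {w α v : ℂ} (h : LSeriesHasSum f (w + α) v) :
    LSeriesHasSum (fun n => f n * (n : ℂ) ^ (-α)) w v := by
  refine HasSum.congr_fun h fun n => ?_
  rcases eq_or_ne n 0 with rfl | hn
  · simp
  · rw [LSeries.term_of_ne_zero hn, LSeries.term_of_ne_zero hn,
      cpow_add _ _ (Nat.cast_ne_zero.mpr hn), cpow_neg]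
    field_simp

theorem lSeriesHasSum_additiveChar (a : ℝ) {s : ℂ} (hs : 1 < s.re) :
    LSeriesHasSum (fun n : ℕ => additiveChar (a * n)) s (HurwitzZeta.expZeta a s) := by
  refine (HurwitzZeta.LSeriesHasSum_exp a hs).congr_fun fun n => ?_
  congr 1
  ext n
  simp only [additiveChar]
  push_cast
  ring_nf

/-- Replacing `e` by its residue `a` in `e(de/q)` decouples `d` from `e`, so each class gives a
genuine Dirichlet convolution. -/
theorem twistedCoeff_eq_sum_convolution (α γ : ℂ) {q : ℕ} (hq : q ≠ 0) :
    twistedCoeff α γ q = ∑ a ∈ Finset.range q,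
      LSeries.convolution (fun d : ℕ => additiveChar ((a / q : ℝ) * d) * (d : ℂ) ^ (-α))
      (fun e : ℕ => (if e % q = a then (1 : ℂ) else 0) * (ArithmeticFunction.moebius e : ℂ) *
        (e : ℂ) ^ (-γ)) := by
  ext n
  simp only [Finset.sum_apply, LSeries.convolution_def]
  rw [Finset.sum_comm, twistedCoeff, ratioCoeff, Finset.sum_mul]
  refine Finset.sum_congr rfl fun p hp => ?_
  rw [Finset.sum_eq_single (p.2 % q)]
  · have h : additiveChar (((p.2 % q : ℕ) / q : ℝ) * p.1) = additiveChar ((n : ℝ) / q) := by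
      rw [← (Nat.mem_divisorsAntidiagonal.mp hp).1, div_mul_eq_mul_div, ← Nat.cast_mul]
      refine additiveChar_natCast_div_congr hq ?_
      rw [mul_comm p.1 p.2]
      exact (Nat.mod_modEq p.2 q).mul_right p.1
    rw [h, if_pos rfl]
    ring
  · intro b _ hb
    rw [if_neg (Ne.symm hb)]
    ring
  · intro h
    exact absurd (Finset.mem_range.mpr (Nat.mod_lt _ (Nat.pos_of_ne_zero hq))) h

theorem natCast_div_ne_zero_unitAddCircle {a q : ℕ} (ha : a ≠ 0) (haq : a < q) :
    ((a / q : ℝ) : UnitAddCircle) ≠ 0 := by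
  have hq : (0 : ℝ) < q := by exact_mod_cast (Nat.pos_of_ne_zero ha).trans haq
  have ha' : (0 : ℝ) < a := by exact_mod_cast Nat.pos_of_ne_zero ha
  intro h
  have h1 : (a / q : ℝ) < 1 := (div_lt_one hq).mpr (by exact_mod_cast haq)
  obtain ⟨n, hn⟩ := (AddCircle.coe_eq_zero_iff (1 : ℝ)).mp h
  rw [zsmul_eq_mul, mul_one] at hn
  rw [← hn] at h1
  have h0 : (0 : ℝ) < n := hn ▸ div_pos ha' hq
  have : (0 : ℤ) < n := by exact_mod_cast h0
  have : n < (1 : ℤ) := by exact_mod_cast h1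
  omega

/-- The residue at `w = 1 - α` of the continuation of `∑ I_{α,γ}(m) e(m/q) m^{-w}`. -/
noncomputable def twistedResidue (α γ : ℂ) (q : ℕ) [NeZero q] : ℂ :=
  (ArithmeticFunction.moebius q : ℂ) * (q : ℂ) ^ (-(1 - α + γ)) * trivLInv q (1 - α + γ)

/-- Carrying the holomorphic numerator `P` instead of a pole covers the case `α = γ` uniformly:
there `P (1 - α) = 0`, because `trivLInv` vanishes at `1`, and the singularity is removable. -/
theorem GeneralizedRiemannHypothesis.exists_twisted_continuation
    (hGRH : GeneralizedRiemannHypothesis) (α γ : ℂ) (q : ℕ) [NeZero q] :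
    ∃ P : ℂ → ℂ, DifferentiableOn ℂ P {w | 1 / 2 < (w + γ).re} ∧
      P (1 - α) = twistedResidue α γ q ∧
      ∀ w : ℂ, 1 / 2 < (w + γ).re → w ≠ 1 - α →
        ContinuesTo (twistedCoeff α γ q) w (fun w => P w / (w - (1 - α))) := by
  have hq : q ≠ 0 := NeZero.ne q
  have hM := fun a : ℕ =>
    hGRH.continuesToHalf_residueClass_moebius (q := q) fun x => if x.val = a then 1 else 0
  choose M hMd hMs using hM
  simp only [ZMod.val_natCast] at hMs
  -- For the class `a = 0` the closed form replaces the unspecified continuation `M 0`, so that the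
  -- residue can be read off.
  set M₀ : ℂ → ℂ := fun s => (ArithmeticFunction.moebius q : ℂ) * (q : ℂ) ^ (-s) * trivLInv q s
    with hM₀
  have hM₀d : DifferentiableOn ℂ M₀ {s | 1 / 2 < s.re} := by
    refine DifferentiableOn.mul (fun s _ => ?_) (hGRH.differentiableOn_trivLInv q)
    exact (((differentiableAt_neg_iff.mpr differentiableAt_id).const_cpow
      (.inl (Nat.cast_ne_zero.mpr hq))).const_mul _).differentiableWithinAt
  have hM₀s : ∀ s : ℂ, 1 < s.re → LSeriesHasSum (fun n : ℕ => (if n % q = 0 then (1 : ℂ) else 0) *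
      (ArithmeticFunction.moebius n : ℂ)) s (M₀ s) := fun s hs => by
    convert lSeriesHasSum_dvd_moebius q hs using 2 with n
    simp [Nat.dvd_iff_mod_eq_zero]
  set U : Set ℂ := {w | 1 / 2 < (w + γ).re}
  have hUo : IsOpen U := isOpen_lt continuous_const (by fun_prop)
  have hshift : ∀ {N : ℂ → ℂ}, DifferentiableOn ℂ N {s | 1 / 2 < s.re} →
      DifferentiableOn ℂ (fun w => N (w + γ)) U := fun {N} hN =>
    hN.comp (g := N) (f := fun w => w + γ) (by fun_prop) fun w hw => hw
  -- The factor `w - (1 - α) = (w + α) - 1` absorbs the pole of `ζ(w + α)` in the class `a = 0` and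
  -- kills all other classes at `w = 1 - α`.
  set P : ℂ → ℂ := fun w => trivLEntire 1 (w + α) * M₀ (w + γ) + (w - (1 - α)) *
    ∑ a ∈ (Finset.range q).erase 0,
      HurwitzZeta.expZeta ((a / q : ℝ) : UnitAddCircle) (w + α) * M a (w + γ) with hP
  have hPd : DifferentiableOn ℂ P U := by
    refine DifferentiableOn.add (DifferentiableOn.mul ?_ (hshift hM₀d))
      (DifferentiableOn.mul (by fun_prop) (.fun_sum fun a ha =>
        DifferentiableOn.mul ?_ (hshift (hMd a))))
    · exact ((differentiable_trivLEntire 1).comp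
        (differentiable_id.add_const α)).differentiableOn
    · rw [Finset.mem_erase, Finset.mem_range] at ha
      exact ((HurwitzZeta.differentiable_expZeta_of_ne_zero
        (natCast_div_ne_zero_unitAddCircle ha.1 ha.2)).comp
        (differentiable_id.add_const α)).differentiableOn
  refine ⟨P, hPd, by simp [hP, hM₀, trivLEntire_one_one, twistedResidue], fun w hw hne => ?_⟩
  have hPa : AnalyticOnNhd ℂ P U := hPd.analyticOnNhd hUo
  refine ⟨(hPa w hw).div (by fun_prop) (sub_ne_zero.mpr hne), 1 / 2 - γ.re, ?_, ?_,
    1 + ‖α‖ + ‖γ‖, fun v hv => ?_⟩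
  · have : 1 / 2 < (w + γ).re := hw
    rw [add_re] at this
    linarith
  · intro v hv
    have hv' : v ∈ U := by
      simp only [Set.mem_ofPred_eq, U, add_re] at hv ⊢
      linarith
    exact (hPa v hv').meromorphicAt.div (by fun_prop)
  · have hα := (abs_le.mp (abs_re_le_norm α)).1
    have hγ := (abs_le.mp (abs_re_le_norm γ)).1
    have hvα : 1 < (v + α).re := by
      rw [add_re]; linarith [norm_nonneg γ]
    have hvγ : 1 < (v + γ).re := by
      rw [add_re]; linarith [norm_nonneg α]
    have hne1 : v + α ≠ 1 := by
      intro h; rw [h] at hvα; simp at hvα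
    have hsum : LSeriesHasSum (twistedCoeff α γ q) v
        (∑ a ∈ Finset.range q, HurwitzZeta.expZeta ((a / q : ℝ) : UnitAddCircle) (v + α) *
          (if a = 0 then M₀ (v + γ) else M a (v + γ))) := by
      rw [twistedCoeff_eq_sum_convolution α γ hq]
      refine LSeriesHasSum.sum fun a _ => LSeriesHasSum.convolution
        (lSeriesHasSum_additiveChar _ hvα).mul_cpow_neg ?_
      split_ifs with h
      · subst h
        exact (hM₀s _ hvγ).mul_cpow_neg
      · exact (hMs a _ hvγ).mul_cpow_neg
    refine ⟨hsum.LSeriesSummable, ?_⟩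
    rw [hsum.LSeries_eq, ← Finset.add_sum_erase _ _
      (Finset.mem_range.mpr (Nat.pos_of_ne_zero hq))]
    have hsub : v - (1 - α) ≠ 0 := by
      intro h; exact hne1 (by linear_combination h)
    have herase : ∑ a ∈ (Finset.range q).erase 0,
        HurwitzZeta.expZeta ((a / q : ℝ) : UnitAddCircle) (v + α) *
          (if a = 0 then M₀ (v + γ) else M a (v + γ)) = ∑ a ∈ (Finset.range q).erase 0,
        HurwitzZeta.expZeta ((a / q : ℝ) : UnitAddCircle) (v + α) * M a (v + γ) :=
      Finset.sum_congr rfl fun a ha => by rw [if_neg (Finset.ne_of_mem_erase ha)]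
    rw [herase]
    simp only [hP, trivLEntire_one_of_ne hne1, Nat.cast_zero, zero_div, AddCircle.coe_zero,
      HurwitzZeta.expZeta_zero, if_true]
    field_simp
    ring

/-! ### The double contour integral. -/

theorem circleIntegral_mul_div_sub {f : ℂ → ℂ} {c a : ℂ} {R : ℝ} (ha : a ∈ ball c R)
    {U : Set ℂ} (hcU : closedBall c R ⊆ U) (hf : DifferentiableOn ℂ f U) :
    (∮ z in C(c, R), f z / (z - a)) = 2 * Real.pi * I * f a := by
  have hd : DiffContOnCl ℂ f (ball c R) :=
    ⟨hf.mono (ball_subset_closedBall.trans hcU),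
      hf.continuousOn.mono (closure_ball_subset_closedBall.trans hcU)⟩
  have := hd.circleIntegral_sub_inv_smul ha
  simpa [div_eq_inv_mul, smul_eq_mul] using this

/-- Cauchy's formula in `z` and then in `w`. The formulas for `F₁` and `F₂` are required only on the
circle, which is where the continued values are known to be regular. -/
theorem circleIntegral_circleIntegral_eq {G F₁ F₂ P₁ P₂ : ℂ → ℂ} {a b : ℂ} {ε : ℝ}
    (ha : a ∈ ball (1 : ℂ) ε) (hb : b ∈ ball (1 : ℂ) ε) {U₁ U₂ V : Set ℂ}
    (h₁ : closedBall 1 ε ⊆ U₁) (h₂ : closedBall 1 ε ⊆ U₂)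
    (h₃ : ∀ w ∈ closedBall (1 : ℂ) ε, ∀ z ∈ closedBall (1 : ℂ) ε, w + z ∈ V)
    (hP₁ : DifferentiableOn ℂ P₁ U₁) (hP₂ : DifferentiableOn ℂ P₂ U₂)
    (hG : DifferentiableOn ℂ G V)
    (hF₁ : ∀ w ∈ sphere (1 : ℂ) ε, F₁ w = P₁ w / (w - a))
    (hF₂ : ∀ w ∈ sphere (1 : ℂ) ε, F₂ w = P₂ w / (w - b)) :
    (∮ w in C(1, ε), ∮ z in C(1, ε), G (w + z) * F₁ w * F₂ z) =
      (2 * Real.pi * I) ^ 2 * (G (a + b) * P₁ a * P₂ b) := by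
  have hε : 0 ≤ ε := (pos_of_mem_ball ha).le
  have inner : ∀ w ∈ sphere (1 : ℂ) ε, (∮ z in C(1, ε), G (w + z) * F₁ w * F₂ z) =
      2 * Real.pi * I * ((G (w + b) * P₁ w * P₂ b) / (w - a)) := by
    intro w hw
    have hw' := sphere_subset_closedBall hw
    have h := circleIntegral_mul_div_sub (f := fun z => G (w + z) * F₁ w * P₂ z) hb
      (U := U₂ ∩ (fun z => w + z) ⁻¹' V)
      (fun z hz => ⟨h₂ hz, h₃ w hw' z hz⟩)
      (((hG.comp (f := fun z => w + z) (by fun_prop) fun z hz => hz.2).mul_const _).mul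
        (hP₂.mono Set.inter_subset_left))
    rw [hF₁ w hw] at h
    rw [circleIntegral.integral_congr hε (g := fun z =>
      G (w + z) * (P₁ w / (w - a)) * P₂ z / (z - b)), h]
    · ring
    · intro z hz
      simp only [hF₁ w hw, hF₂ z hz]
      ring
  rw [circleIntegral.integral_congr hε inner]
  have h := circleIntegral_mul_div_sub (f := fun w => G (w + b) * P₁ w * P₂ b) ha
      (U := U₁ ∩ (fun w => w + b) ⁻¹' V)
      (fun w hw => ⟨h₁ hw, h₃ w hw b (ball_subset_closedBall hb)⟩)
      (((hG.comp (f := fun w => w + b) (by fun_prop) fun z hz => hz.2).mul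
        (hP₁.mono Set.inter_subset_left)).mul_const _)
  rw [circleIntegral.integral_const_mul, h]
  ring

/-! ### Ramanujan sums, their Dirichlet series and the functional equation. -/

theorem sum_divisors_moebius_eq (n : ℕ) :
    ∑ d ∈ n.divisors, ArithmeticFunction.moebius d = if n = 1 then 1 else 0 := by
  rw [← ArithmeticFunction.coe_zeta_mul_apply, ArithmeticFunction.coe_zeta_mul_moebius,
    ArithmeticFunction.one_apply]

theorem sum_range_additiveChar (n h : ℕ) (hn : n ≠ 0) :
    ∑ b ∈ Finset.range n, additiveChar ((b : ℝ) * h / n) = if n ∣ h then (n : ℂ) else 0 := by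
  have hn' : (n : ℂ) ≠ 0 := Nat.cast_ne_zero.mpr hn
  have hpow : ∀ b : ℕ, additiveChar ((b : ℝ) * h / n) = additiveChar ((h : ℝ) / n) ^ b := by
    intro b
    rw [additiveChar, additiveChar, ← Complex.exp_nat_mul]
    congr 1
    push_cast
    ring
  simp_rw [hpow]
  split_ifs with hd
  · obtain ⟨k, rfl⟩ := hd
    have : ((n * k : ℕ) : ℝ) / n = (k : ℝ) := by
      push_cast
      field_simp
    simp_rw [this, additiveChar_natCast, one_pow]
    simp
  · have hne : additiveChar ((h : ℝ) / n) ≠ 1 := by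
      intro h1
      obtain ⟨k, hk⟩ := Complex.exp_eq_one_iff.mp h1
      have h2 : (h : ℂ) / n = k := by
        have : (2 * Real.pi * I : ℂ) ≠ 0 := by simp [Real.pi_ne_zero]
        apply mul_left_cancel₀ this
        rw [mul_comm _ (k : ℂ), ← hk]
        push_cast
        ring
      rw [div_eq_iff hn'] at h2
      have h3 : (h : ℤ) = k * n := by exact_mod_cast h2
      exact hd (Int.natCast_dvd_natCast.mp ⟨k, by rw [h3, mul_comm]⟩)
    rw [geom_sum_eq hne, ← hpow n]
    have : (n : ℝ) * h / n = (h : ℝ) := by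
      have : (n : ℝ) ≠ 0 := Nat.cast_ne_zero.mpr hn
      field_simp
    rw [this, additiveChar_natCast, sub_self, zero_div]

/-- Möbius inversion detects `(a, q) = 1`. The multiples `a = db` then run through a complete system
modulo `q / d`, where the exponential sum is trivial. -/
theorem ramanujanSum_eq_sum_divisors {q : ℕ} (hq : q ≠ 0) (h : ℕ) :
    ramanujanSum q h = ∑ d ∈ q.divisors, (ArithmeticFunction.moebius d : ℂ) *
      if q / d ∣ h then ((q / d : ℕ) : ℂ) else 0 := by
  have step : ∀ a : ℕ, (if a.Coprime q then additiveChar ((a : ℝ) * h / q) else 0) =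
      ∑ d ∈ q.divisors, if d ∣ a then
        (ArithmeticFunction.moebius d : ℂ) * additiveChar ((a : ℝ) * h / q) else 0 := by
    intro a
    have h1 := congrArg (fun x : ℤ => (x : ℂ)) (sum_divisors_moebius_eq (a.gcd q))
    have h2 : (a.gcd q).divisors = q.divisors.filter (· ∣ a) := by
      ext d
      simp only [Nat.mem_divisors, Finset.mem_filter, Nat.dvd_gcd_iff, ne_eq,
        Nat.gcd_eq_zero_iff]
      tauto
    rw [h2] at h1
    rw [← Finset.sum_filter, ← Finset.sum_mul]
    push_cast at h1
    rw [h1]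
    simp only [Nat.coprime_iff_gcd_eq_one]
    split_ifs <;> simp
  rw [ramanujanSum, Finset.sum_filter, Finset.sum_congr rfl fun a _ => step a, Finset.sum_comm]
  refine Finset.sum_congr rfl fun d hd => ?_
  obtain ⟨k, rfl⟩ := Nat.dvd_of_mem_divisors hd
  have hd0 : d ≠ 0 := left_ne_zero_of_mul hq
  have hk0 : k ≠ 0 := right_ne_zero_of_mul hq
  rw [Nat.mul_div_cancel_left k (Nat.pos_of_ne_zero hd0), ← sum_range_additiveChar k h hk0,
    Finset.mul_sum, ← Finset.sum_filter]
  symm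
  refine Finset.sum_bij (fun b _ => d * b) (fun b hb => ?_) (fun b _ c _ hbc => ?_)
    (fun a ha => ?_) (fun b _ => ?_)
  · rw [Finset.mem_filter, Finset.mem_range]
    exact ⟨Nat.mul_lt_mul_of_pos_left (Finset.mem_range.mp hb) (Nat.pos_of_ne_zero hd0),
      dvd_mul_right d b⟩
  · exact Nat.eq_of_mul_eq_mul_left (Nat.pos_of_ne_zero hd0) hbc
  · rw [Finset.mem_filter, Finset.mem_range] at ha
    obtain ⟨h1, b, rfl⟩ := ha
    exact ⟨b, Finset.mem_range.mpr (lt_of_mul_lt_mul_left h1 (Nat.zero_le d)), rfl⟩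
  · have h1 : (d : ℝ) ≠ 0 := Nat.cast_ne_zero.mpr hd0
    have h2 : (k : ℝ) ≠ 0 := Nat.cast_ne_zero.mpr hk0
    congr 2
    push_cast
    field_simp

theorem lSeriesHasSum_ramanujanSum {q : ℕ} (hq : q ≠ 0) {u : ℂ} (hu : 1 < u.re) :
    LSeriesHasSum (ramanujanSum q) u (riemannZeta u *
      ∑ d ∈ q.divisors, (ArithmeticFunction.moebius d : ℂ) * ((q / d : ℕ) : ℂ) ^ (1 - u)) := by
  have h := LSeriesHasSum.sum (S := q.divisors) fun d hd =>
    (lSeriesHasSum_dilate (g := q / d)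
      (Nat.div_pos (Nat.divisor_le hd) (Nat.pos_of_mem_divisors hd)).ne'
      (LSeriesHasSum_one hu)).smul ((ArithmeticFunction.moebius d : ℂ) * ((q / d : ℕ) : ℂ))
  convert h using 1
  · ext n
    rw [ramanujanSum_eq_sum_divisors hq, Finset.sum_apply]
    exact Finset.sum_congr rfl fun d _ => by simp
  · rw [Finset.mul_sum]
    refine Finset.sum_congr rfl fun d hd => ?_
    have : ((q / d : ℕ) : ℂ) ≠ 0 := Nat.cast_ne_zero.mpr
      (Nat.div_pos (Nat.divisor_le hd) (Nat.pos_of_mem_divisors hd)).ne'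
    rw [sub_eq_add_neg, cpow_add _ _ this, cpow_one]
    ring

theorem toArithmeticFunction_cpow_isMultiplicative (v : ℂ) :
    (toArithmeticFunction fun n : ℕ => (n : ℂ) ^ v).IsMultiplicative := by
  rw [ArithmeticFunction.IsMultiplicative.iff_ne_zero]
  refine ⟨by simp [toArithmeticFunction], fun {m n} hm hn _ => ?_⟩
  simp [toArithmeticFunction, hm, hn, natCast_mul_natCast_cpow]

theorem natCast_cpow_eq_prod_primeFactors {q : ℕ} (hq : Squarefree q) (v : ℂ) :
    (q : ℂ) ^ v = ∏ p ∈ q.primeFactors, (p : ℂ) ^ v := by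
  have h := (toArithmeticFunction_cpow_isMultiplicative v).prod_primeFactors hq
  simp only [toArithmeticFunction, ArithmeticFunction.coe_mk, if_neg hq.ne_zero] at h
  rw [← h]
  exact Finset.prod_congr rfl fun p hp => by
    rw [if_neg (Nat.prime_of_mem_primeFactors hp).ne_zero]

/-- Factor out `q ^ v`; what remains is `∑ μ(d) d^{-v} = ∏ (1 - p^{-v})`. -/
theorem sum_divisors_moebius_mul_cpow {q : ℕ} (hq : Squarefree q) (v : ℂ) :
    ∑ d ∈ q.divisors, (ArithmeticFunction.moebius d : ℂ) * ((q / d : ℕ) : ℂ) ^ v =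
      ∏ p ∈ q.primeFactors, ((p : ℂ) ^ v - 1) := by
  have h :=
    (toArithmeticFunction_cpow_isMultiplicative (-v)).prodPrimeFactors_one_sub_of_squarefree _ hq
  have h1 : ∀ p ∈ q.primeFactors, (p : ℂ) ^ v - 1 =
      (p : ℂ) ^ v * (1 - toArithmeticFunction (fun n : ℕ => (n : ℂ) ^ (-v)) p) := by
    intro p hp
    have hp0 := (Nat.prime_of_mem_primeFactors hp).ne_zero
    have hp1 : (p : ℂ) ≠ 0 := Nat.cast_ne_zero.mpr hp0
    have hp2 : (p : ℂ) ^ v ≠ 0 := by simp [cpow_eq_zero_iff, hp1]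
    simp only [toArithmeticFunction, ArithmeticFunction.coe_mk, if_neg hp0, cpow_neg]
    field_simp
  rw [Finset.prod_congr rfl h1, Finset.prod_mul_distrib, h,
    ← natCast_cpow_eq_prod_primeFactors hq, Finset.mul_sum]
  refine Finset.sum_congr rfl fun d hd => ?_
  have hd0 := (Nat.pos_of_mem_divisors hd).ne'
  obtain ⟨k, rfl⟩ := Nat.dvd_of_mem_divisors hd
  have hd1 : (d : ℂ) ≠ 0 := Nat.cast_ne_zero.mpr hd0
  have hd2 : (d : ℂ) ^ v ≠ 0 := by simp [cpow_eq_zero_iff, hd1]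
  rw [Nat.mul_div_cancel_left k (Nat.pos_of_ne_zero hd0)]
  simp only [toArithmeticFunction, ArithmeticFunction.coe_mk, if_neg hd0, cpow_neg]
  rw [Nat.cast_mul, natCast_mul_natCast_cpow]
  field_simp

theorem zetaChi_one_sub_mul_riemannZeta {u : ℂ} (hu : 1 < u.re) :
    zetaChi (1 - u) * riemannZeta u = riemannZeta (1 - u) := by
  have h1 : ∀ n : ℕ, u ≠ -n := fun n h => by
    rw [h, neg_re, natCast_re] at hu
    linarith [(Nat.cast_nonneg n : (0 : ℝ) ≤ n)]
  have h2 : u ≠ 1 := fun h => by simp [h] at hu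
  have hpi : (0 : ℝ) ≤ Real.pi := Real.pi_pos.le
  rw [riemannZeta_one_sub h1 h2, zetaChi]
  have h3 : Complex.sin (Real.pi * (1 - u) / 2) = Complex.cos (Real.pi * u / 2) := by
    rw [← Complex.sin_pi_div_two_sub]
    ring_nf
  have h4 : (2 * Real.pi : ℂ) ^ (-u) = 2 ^ (-u) * (Real.pi : ℂ) ^ (-u) := by
    have := mul_cpow_ofReal_nonneg (a := 2) (b := Real.pi) (by norm_num) hpi (-u)
    simpa using this
  have h5 : (2 : ℂ) ^ (1 - u) = 2 * 2 ^ (-u) := by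
    rw [sub_eq_add_neg, cpow_add _ _ two_ne_zero, cpow_one]
  rw [h3, h4, h5, sub_sub_cancel, show (1 : ℂ) - u - 1 = -u by ring]
  ring

theorem differentiableAt_zetaChi {v : ℂ} (hv : v.re < 1) : DifferentiableAt ℂ zetaChi v := by
  have h1 : ∀ n : ℕ, 1 - v ≠ -n := fun n h => by
    have := congrArg re h
    rw [sub_re, one_re, neg_re, natCast_re] at this
    linarith [(Nat.cast_nonneg n : (0 : ℝ) ≤ n)]
  unfold zetaChi
  refine (((differentiableAt_id.const_cpow (.inl two_ne_zero)).mul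
    ((differentiableAt_id.sub_const 1).const_cpow (.inl ?_))).mul (by fun_prop)).mul ?_
  · exact_mod_cast Real.pi_ne_zero
  · exact (Complex.differentiableAt_Gamma _ h1).comp v (by fun_prop)

theorem lSeriesSummable_ramanujanSum {q : ℕ} (hq : q ≠ 0) {u : ℂ} (hu : 1 < u.re) :
    LSeriesSummable (ramanujanSum q) u :=
  (lSeriesHasSum_ramanujanSum hq hu).LSeriesSummable

theorem differentiableOn_lSeries_ramanujanSum {q : ℕ} (hq : q ≠ 0) :
    DifferentiableOn ℂ (LSeries (ramanujanSum q)) {u | 1 < u.re} := by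
  refine (LSeries_analyticOnNhd _).differentiableOn.mono fun u hu => ?_
  have : LSeries.abscissaOfAbsConv (ramanujanSum q) ≤ (1 : ℝ) :=
    LSeries.abscissaOfAbsConv_le_of_forall_lt_LSeriesSummable fun y hy =>
      lSeriesSummable_ramanujanSum hq (by simpa using hy)
  exact lt_of_le_of_lt this (by exact_mod_cast hu)

/-! ### Sums over squarefree integers as Euler products. -/

/-- The multiplicative function supported on squarefree integers with value `h p` at each
prime `p`. -/
noncomputable def squarefreeProd (h : ℕ → ℂ) (q : ℕ) : ℂ :=
  if Squarefree q then ∏ p ∈ q.primeFactors, h p else 0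

theorem squarefreeProd_one (h : ℕ → ℂ) : squarefreeProd h 1 = 1 := by
  simp [squarefreeProd]

theorem squarefreeProd_zero (h : ℕ → ℂ) : squarefreeProd h 0 = 0 := by
  simp [squarefreeProd]

theorem squarefreeProd_mul (h : ℕ → ℂ) {m n : ℕ} (hmn : m.Coprime n) :
    squarefreeProd h (m * n) = squarefreeProd h m * squarefreeProd h n := by
  simp only [squarefreeProd, Nat.squarefree_mul hmn, hmn.primeFactors_mul,
    Finset.prod_union hmn.disjoint_primeFactors]
  by_cases h1 : Squarefree m <;> by_cases h2 : Squarefree n <;> simp [h1, h2]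

theorem tsum_squarefreeProd_prime_pow (h : ℕ → ℂ) {p : ℕ} (hp : p.Prime) :
    ∑' e : ℕ, squarefreeProd h (p ^ e) = 1 + h p := by
  rw [tsum_eq_sum (s := Finset.range 2)]
  · simp [Finset.sum_range_succ, squarefreeProd, hp.squarefree,
      hp.primeFactors]
  · intro e he
    rw [Finset.mem_range, not_lt] at he
    rw [squarefreeProd, if_neg]
    intro hs
    have h1 : p * p ∣ p ^ e := by
      rw [← pow_two]
      exact pow_dvd_pow p he
    exact hp.one_lt.ne' (Nat.isUnit_iff.mp (hs p h1))

/-- The bridge between the sum over moduli `q` and the Euler product of the Rankin–Selberg series.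
-/
theorem hasProd_one_add_of_summable_squarefreeProd {h : ℕ → ℂ}
    (hs : Summable fun q => ‖squarefreeProd h q‖) :
    HasProd (fun p : Nat.Primes => 1 + h p) (∑' q, squarefreeProd h q) := by
  have := EulerProduct.eulerProduct_hasProd (squarefreeProd_one h) (squarefreeProd_mul h) hs
    (squarefreeProd_zero h)
  simpa only [fun p : Nat.Primes => tsum_squarefreeProd_prime_pow h p.prop] using this

theorem zeta_pow_isMultiplicative (K : ℕ) :
    ((ArithmeticFunction.zeta : ArithmeticFunction ℂ) ^ K).IsMultiplicative := by
  induction K with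
  | zero => simp
  | succ K ih =>
    rw [pow_succ]
    exact ih.mul ArithmeticFunction.isMultiplicative_zeta.natCast

theorem zeta_pow_apply_prime (K : ℕ) {p : ℕ} (hp : p.Prime) :
    ((ArithmeticFunction.zeta : ArithmeticFunction ℂ) ^ K) p = K := by
  induction K with
  | zero => simp [hp.ne_one]
  | succ K ih =>
    rw [pow_succ', ArithmeticFunction.coe_zeta_mul_apply, hp.sum_divisors, ih,
      (zeta_pow_isMultiplicative K).map_one]
    push_cast
    ring

/-- The coefficients of `ζ(s)^K` are multiplicative with value `K` at primes, so on squarefree `q`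
they equal `K^{ω(q)}`. This makes them a summable majorant for `squarefreeProd`. -/
theorem lSeriesSummable_zeta_pow (K : ℕ) {s : ℂ} (hs : 1 < s.re) :
    LSeriesSummable (fun n => ((ArithmeticFunction.zeta : ArithmeticFunction ℂ) ^ K) n) s := by
  induction K with
  | zero =>
    refine LSeriesSummable_of_bounded_of_one_lt_re (m := 1) (fun n _ => ?_) hs
    rw [pow_zero, ArithmeticFunction.one_apply]
    split_ifs <;> simp
  | succ K ih =>
    rw [pow_succ]
    refine ArithmeticFunction.LSeriesSummable_mul ih ?_
    simpa using ArithmeticFunction.LSeriesSummable_zeta_iff.mpr hs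

/-- A dominating function for `squarefreeProd h` when `‖h p‖ ≤ K p ^ (-x)`. -/
noncomputable def squarefreeBound (K : ℕ) (x : ℝ) (q : ℕ) : ℝ :=
  ‖LSeries.term (fun n => ((ArithmeticFunction.zeta : ArithmeticFunction ℂ) ^ K) n) x q‖

theorem summable_squarefreeBound (K : ℕ) {x : ℝ} (hx : 1 < x) :
    Summable (squarefreeBound K x) :=
  (lSeriesSummable_zeta_pow K (s := x) (by simpa using hx)).norm

theorem norm_squarefreeProd_le {h : ℕ → ℂ} {K : ℕ} {x : ℝ}
    (hh : ∀ p : ℕ, p.Prime → ‖h p‖ ≤ K * (p : ℝ) ^ (-x)) (q : ℕ) :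
    ‖squarefreeProd h q‖ ≤ squarefreeBound K x q := by
  by_cases hq : Squarefree q
  · have h1 : squarefreeBound K x q = ∏ p ∈ q.primeFactors, (K * (p : ℝ) ^ (-x)) := by
      rw [squarefreeBound, LSeries.term_of_ne_zero hq.ne_zero, div_eq_mul_inv, ← cpow_neg,
        ← (zeta_pow_isMultiplicative K).prod_primeFactors hq,
        natCast_cpow_eq_prod_primeFactors hq, ← Finset.prod_mul_distrib, norm_prod]
      refine Finset.prod_congr rfl fun p hp => ?_
      have hp' := Nat.prime_of_mem_primeFactors hp
      rw [zeta_pow_apply_prime K hp', norm_mul, norm_natCast_cpow_of_pos hp'.pos]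
      simp
    rw [h1, squarefreeProd, if_pos hq, norm_prod]
    exact Finset.prod_le_prod (fun _ _ => norm_nonneg _) fun p hp =>
      hh p (Nat.prime_of_mem_primeFactors hp)
  · rw [squarefreeProd, if_neg hq, norm_zero]
    exact norm_nonneg _

/-! ### Local factors of the Rankin–Selberg series. -/

theorem ratioCoeff_eq_mul (α γ : ℂ) (n : ℕ) : ratioCoeff α γ n =
    (toArithmeticFunction (fun d : ℕ => (d : ℂ) ^ (-α)) *
      ((ArithmeticFunction.moebius : ArithmeticFunction ℂ).pmul
        (toArithmeticFunction fun e : ℕ => (e : ℂ) ^ (-γ))) : ArithmeticFunction ℂ) n := by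
  rw [ArithmeticFunction.mul_apply, ratioCoeff]
  refine Finset.sum_congr rfl fun p hp => ?_
  have h := Nat.ne_zero_of_mem_divisorsAntidiagonal hp
  rw [ArithmeticFunction.pmul_apply, ArithmeticFunction.intCoe_apply]
  simp only [toArithmeticFunction, ArithmeticFunction.coe_mk, h.1, h.2, if_false]
  ring

theorem ratioCoeff_mul (α γ : ℂ) {m n : ℕ} (h : m.Coprime n) :
    ratioCoeff α γ (m * n) = ratioCoeff α γ m * ratioCoeff α γ n := by
  simp only [ratioCoeff_eq_mul]
  exact ((toArithmeticFunction_cpow_isMultiplicative (-α)).mul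
    (ArithmeticFunction.isMultiplicative_moebius.intCast.pmul
      (toArithmeticFunction_cpow_isMultiplicative (-γ)))).map_mul_of_coprime h

theorem ratioCoeff_one (α γ : ℂ) : ratioCoeff α γ 1 = 1 := by
  simp [ratioCoeff]

theorem natCast_pow_cpow (p k : ℕ) (v : ℂ) : ((p ^ k : ℕ) : ℂ) ^ v = ((p : ℂ) ^ v) ^ k := by
  rw [Nat.cast_pow, ← natCast_cpow_natCast_mul, mul_comm, ← cpow_mul_nat]

theorem ratioCoeff_prime_pow_succ (α γ : ℂ) {p : ℕ} (hp : p.Prime) (k : ℕ) :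
    ratioCoeff α γ (p ^ (k + 1)) =
      ((p : ℂ) ^ (-α)) ^ k * ((p : ℂ) ^ (-α) - (p : ℂ) ^ (-γ)) := by
  rw [ratioCoeff, Nat.sum_divisorsAntidiagonal' fun d e =>
    (ArithmeticFunction.moebius e : ℂ) * (d : ℂ) ^ (-α) * (e : ℂ) ^ (-γ),
    Nat.sum_divisors_prime_pow hp, Finset.sum_range_succ', Finset.sum_range_succ']
  rw [Finset.sum_eq_zero]
  · have h1 : p ^ (k + 1) / p ^ (0 + 1) = p ^ k := by
      rw [Nat.pow_div (by omega) hp.pos]; simp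
    rw [h1, pow_zero, Nat.div_one, natCast_pow_cpow, natCast_pow_cpow]
    rw [natCast_pow_cpow p (k + 1), pow_succ ((p : ℂ) ^ (-α)), zero_add, pow_one,
      ArithmeticFunction.moebius_apply_prime hp]
    simp
    ring
  · intro x _
    rw [ArithmeticFunction.moebius_apply_prime_pow hp (by omega), if_neg (by omega)]
    simp

theorem norm_natCast_cpow_le {d n : ℕ} (hd : d ≠ 0) (hdn : d ≤ n) (v : ℂ) :
    ‖(d : ℂ) ^ v‖ ≤ (n : ℝ) ^ ‖v‖ := by
  rw [norm_natCast_cpow_of_pos (Nat.pos_of_ne_zero hd)]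
  have h1 : (1 : ℝ) ≤ d := by exact_mod_cast Nat.one_le_iff_ne_zero.mpr hd
  calc (d : ℝ) ^ v.re ≤ (d : ℝ) ^ ‖v‖ := Real.rpow_le_rpow_of_exponent_le h1 (re_le_norm v)
    _ ≤ (n : ℝ) ^ ‖v‖ :=
      Real.rpow_le_rpow (by positivity) (by exact_mod_cast hdn) (norm_nonneg v)

/-- A crude bound, with at most `n` divisors, suffices: it serves only to give some half-plane of
absolute convergence. -/
theorem norm_ratioCoeff_le (α γ : ℂ) {n : ℕ} (hn : n ≠ 0) :
    ‖ratioCoeff α γ n‖ ≤ (n : ℝ) ^ (1 + ‖α‖ + ‖γ‖) := by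
  have hn' : (0 : ℝ) < n := by exact_mod_cast Nat.pos_of_ne_zero hn
  have hterm : ∀ p ∈ n.divisorsAntidiagonal, ‖(ArithmeticFunction.moebius p.2 : ℂ) *
      (p.1 : ℂ) ^ (-α) * (p.2 : ℂ) ^ (-γ)‖ ≤ (n : ℝ) ^ (‖α‖ + ‖γ‖) := by
    intro p hp
    have h := Nat.ne_zero_of_mem_divisorsAntidiagonal hp
    have h1 := norm_natCast_cpow_le h.1
      (Nat.divisor_le (Nat.fst_mem_divisors_of_mem_antidiagonal hp)) (-α)
    have h2 := norm_natCast_cpow_le h.2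
      (Nat.divisor_le (Nat.snd_mem_divisors_of_mem_antidiagonal hp)) (-γ)
    have h3 : ‖(ArithmeticFunction.moebius p.2 : ℂ)‖ ≤ 1 := by
      rw [norm_intCast]
      exact_mod_cast ArithmeticFunction.abs_moebius_le_one
    rw [norm_neg] at h1 h2
    rw [norm_mul, norm_mul, Real.rpow_add hn']
    calc _ ≤ 1 * (n : ℝ) ^ ‖α‖ * (n : ℝ) ^ ‖γ‖ := by gcongr
      _ = _ := by ring
  have hcard : (n.divisorsAntidiagonal.card : ℝ) ≤ n := by
    have : n.divisorsAntidiagonal.card = n.divisors.card := by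
      rw [← Nat.map_div_right_divisors, Finset.card_map]
    rw [this]
    exact_mod_cast Nat.card_divisors_le_self n
  calc ‖ratioCoeff α γ n‖ ≤ ∑ p ∈ n.divisorsAntidiagonal, (n : ℝ) ^ (‖α‖ + ‖γ‖) :=
        norm_sum_le_of_le _ hterm
    _ = n.divisorsAntidiagonal.card * (n : ℝ) ^ (‖α‖ + ‖γ‖) := by
        rw [Finset.sum_const, nsmul_eq_mul]
    _ ≤ n * (n : ℝ) ^ (‖α‖ + ‖γ‖) := by gcongr
    _ = (n : ℝ) ^ (1 + ‖α‖ + ‖γ‖) := by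
        rw [add_assoc, Real.rpow_add hn' 1, Real.rpow_one]

theorem lSeriesSummable_ratioCoeff_mul (a b c d : ℂ) {z : ℂ}
    (hz : 3 + ‖a‖ + ‖b‖ + ‖c‖ + ‖d‖ < z.re) :
    LSeriesSummable (fun n => ratioCoeff a c n * ratioCoeff b d n) z := by
  refine LSeriesSummable_of_le_const_mul_rpow hz ⟨1, fun n hn => ?_⟩
  have hn' : (0 : ℝ) < n := by exact_mod_cast Nat.pos_of_ne_zero hn
  rw [norm_mul, one_mul]
  calc _ ≤ (n : ℝ) ^ (1 + ‖a‖ + ‖c‖) * (n : ℝ) ^ (1 + ‖b‖ + ‖d‖) :=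
        mul_le_mul (norm_ratioCoeff_le a c hn) (norm_ratioCoeff_le b d hn) (norm_nonneg _)
          (by positivity)
    _ = _ := by
        rw [← Real.rpow_add hn']
        congr 1
        ring

theorem hasProd_lSeries_of_coprime {f : ℕ → ℂ} (h1 : f 1 = 1)
    (hmul : ∀ {m n : ℕ}, m.Coprime n → f (m * n) = f m * f n) {z : ℂ}
    (hs : LSeriesSummable f z) :
    HasProd (fun p : Nat.Primes => ∑' e : ℕ, LSeries.term f z (p ^ e)) (LSeries f z) := by
  refine EulerProduct.eulerProduct_hasProd (f := LSeries.term f z) ?_ ?_ hs.norm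
    (LSeries.term_zero f z)
  · simp [LSeries.term, h1]
  · intro m n hmn
    rcases eq_or_ne m 0 with rfl | hm
    · simp
    rcases eq_or_ne n 0 with rfl | hn
    · simp
    rw [LSeries.term_of_ne_zero hm, LSeries.term_of_ne_zero hn,
      LSeries.term_of_ne_zero (mul_ne_zero hm hn), hmul hmn, Nat.cast_mul,
      natCast_mul_natCast_cpow]
    field_simp

theorem norm_prime_cpow_neg_lt_one {p : ℕ} (hp : p.Prime) {v : ℂ} (hv : 0 < v.re) :
    ‖(p : ℂ) ^ (-v)‖ < 1 := by
  rw [norm_natCast_cpow_of_pos hp.pos, neg_re]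
  exact Real.rpow_lt_one_of_one_lt_of_neg (by exact_mod_cast hp.one_lt) (by linarith)

/-- Beyond exponent `0` the terms are geometric with ratio `p^{-(z+a+b)}`. Writing `A, B, C, D` for
`p^{-a}, …, p^{-d}`, the numerator is `1 + p^{-z} ((A - C)(B - D) - AB)`, in which `AB` cancels. -/
theorem tsum_term_ratioCoeff_mul (a b c d : ℂ) {z : ℂ} {p : ℕ} (hp : p.Prime)
    (hz : 0 < (z + a + b).re) :
    ∑' e : ℕ, LSeries.term (fun n => ratioCoeff a c n * ratioCoeff b d n) z (p ^ e) =
      (1 - (p : ℂ) ^ (-(z + a + b)))⁻¹ * (1 - (p : ℂ) ^ (-(z + a + d)) -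
        (p : ℂ) ^ (-(z + b + c)) + (p : ℂ) ^ (-(z + c + d))) := by
  have hp0 : (p : ℂ) ≠ 0 := Nat.cast_ne_zero.mpr hp.ne_zero
  have hlt := norm_prime_cpow_neg_lt_one hp hz
  have e2 : ∀ x y : ℂ, (p : ℂ) ^ (-(z + x + y)) =
      (p : ℂ) ^ (-z) * (p : ℂ) ^ (-x) * (p : ℂ) ^ (-y) := fun x y => by
    rw [← cpow_add _ _ hp0, ← cpow_add _ _ hp0]
    ring_nf
  have hterm : ∀ e : ℕ, LSeries.term (fun n => ratioCoeff a c n * ratioCoeff b d n) z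
      (p ^ (e + 1)) = ((p : ℂ) ^ (-(z + a + b))) ^ e * ((p : ℂ) ^ (-z) *
        ((p : ℂ) ^ (-a) - (p : ℂ) ^ (-c)) * ((p : ℂ) ^ (-b) - (p : ℂ) ^ (-d))) := by
    intro e
    rw [LSeries.term_of_ne_zero (pow_ne_zero _ hp.ne_zero), ratioCoeff_prime_pow_succ _ _ hp,
      ratioCoeff_prime_pow_succ _ _ hp, div_eq_mul_inv, ← cpow_neg, natCast_pow_cpow, e2]
    ring
  have hsum := (hasSum_geometric_of_norm_lt_one hlt).mul_right ((p : ℂ) ^ (-z) *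
        ((p : ℂ) ^ (-a) - (p : ℂ) ^ (-c)) * ((p : ℂ) ^ (-b) - (p : ℂ) ^ (-d)))
  simp only [← hterm] at hsum
  have hs := (summable_nat_add_iff (f := fun e => LSeries.term (fun n =>
    ratioCoeff a c n * ratioCoeff b d n) z (p ^ e)) 1).mp hsum.summable
  have hne : 1 - (p : ℂ) ^ (-(z + a + b)) ≠ 0 := by
    intro h
    rw [← sub_eq_zero.mp h] at hlt
    simp at hlt
  rw [hs.tsum_eq_zero_add, hsum.tsum_eq, pow_zero, LSeries.term_of_ne_zero one_ne_zero,
    ratioCoeff_one, ratioCoeff_one]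
  rw [eq_inv_mul_iff_mul_eq₀ hne, mul_add, mul_inv_cancel_left₀ hne]
  simp only [e2, Nat.cast_one, one_cpow]
  ring

theorem meromorphicAt_riemannZeta (s : ℂ) : MeromorphicAt riemannZeta s := by
  have h1 : AnalyticAt ℂ (trivLEntire 1) s :=
    (differentiable_trivLEntire 1).analyticAt s
  have h2 : MeromorphicAt (fun z => trivLEntire 1 z / (z - 1)) s :=
    h1.meromorphicAt.div (by fun_prop)
  refine h2.congr ?_
  rcases eq_or_ne s 1 with rfl | hs
  · filter_upwards [self_mem_nhdsWithin] with z hz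
    have hz' : z - 1 ≠ 0 := sub_ne_zero.mpr hz
    rw [trivLEntire_one_of_ne hz]
    field_simp
  · filter_upwards [nhdsWithin_le_nhds (isOpen_ne.mem_nhds hs)] with z hz
    have hz' : z - 1 ≠ 0 := sub_ne_zero.mpr hz
    rw [trivLEntire_one_of_ne hz]
    field_simp

/-! ### Continuation of the Rankin–Selberg series. -/

/-- The value at the prime `p` of the Euler factor of `𝓑_{a,b,c,d}(z)`, divided by those of
`ζ(z + a + b) / (ζ(z + a + d) ζ(z + b + c))`, minus one. -/
noncomputable def rankinSelbergFactor (a b c d z : ℂ) (p : ℕ) : ℂ :=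
  ((p : ℂ) ^ (-(z + c + d)) - (p : ℂ) ^ (-(z + a + d)) * (p : ℂ) ^ (-(z + b + c))) *
    ((1 - (p : ℂ) ^ (-(z + a + d)))⁻¹ * (1 - (p : ℂ) ^ (-(z + b + c)))⁻¹)

theorem norm_one_sub_prime_cpow_inv_le {p : ℕ} (hp : p.Prime) {v : ℂ} (hv : 1 / 2 < v.re) :
    ‖(1 - (p : ℂ) ^ (-v))⁻¹‖ ≤ 4 := by
  have h2 : (2 : ℝ) ≤ p := by exact_mod_cast hp.two_le
  have h1 : ‖(p : ℂ) ^ (-v)‖ ≤ 3 / 4 := by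
    rw [norm_natCast_cpow_of_pos hp.pos, neg_re]
    calc (p : ℝ) ^ (-v.re) ≤ (p : ℝ) ^ (-(1 / 2) : ℝ) :=
          Real.rpow_le_rpow_of_exponent_le (by linarith) (by linarith)
      _ ≤ (2 : ℝ) ^ (-(1 / 2) : ℝ) :=
          Real.rpow_le_rpow_of_nonpos (by norm_num) h2 (by norm_num)
      _ ≤ 3 / 4 := by
          rw [Real.rpow_neg (by norm_num), ← Real.sqrt_eq_rpow,
            show (3 / 4 : ℝ) = (4 / 3 : ℝ)⁻¹ by norm_num]
          exact inv_anti₀ (by norm_num) (Real.le_sqrt_of_sq_le (by norm_num))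
  have h3 : 1 / 4 ≤ ‖1 - (p : ℂ) ^ (-v)‖ := by
    have := norm_sub_norm_le (1 : ℂ) ((p : ℂ) ^ (-v))
    rw [norm_one] at this
    linarith
  rw [norm_inv, show (4 : ℝ) = (1 / 4)⁻¹ by norm_num]
  exact inv_anti₀ (by norm_num) h3

theorem one_sub_prime_cpow_ne_zero {p : ℕ} (hp : p.Prime) {v : ℂ} (hv : 0 < v.re) :
    1 - (p : ℂ) ^ (-v) ≠ 0 := by
  intro h
  have := norm_prime_cpow_neg_lt_one hp hv
  rw [← sub_eq_zero.mp h, norm_one] at this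
  exact lt_irrefl _ this

/-- Dividing out the zeta factors leaves no first-order term in `X` or `Y`, only `W` and the product
`XY`; hence real parts above `1/2` are enough. The constant is `32 = 2 · 4 · 4`. -/
theorem norm_rankinSelbergFactor_le {a b c d z : ℂ} {κ : ℝ} (h₁ : 1 / 2 + κ ≤ (z + a + d).re)
    (h₂ : 1 / 2 + κ ≤ (z + b + c).re) (h₃ : 1 + κ ≤ (z + c + d).re) (hκ : 0 < κ)
    {p : ℕ} (hp : p.Prime) :
    ‖rankinSelbergFactor a b c d z p‖ ≤ (32 : ℕ) * (p : ℝ) ^ (-(1 + κ)) := by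
  have h1 : (1 : ℝ) ≤ p := by exact_mod_cast hp.one_le
  have hW : ‖(p : ℂ) ^ (-(z + c + d))‖ ≤ (p : ℝ) ^ (-(1 + κ)) := by
    rw [norm_natCast_cpow_of_pos hp.pos, neg_re]
    exact Real.rpow_le_rpow_of_exponent_le h1 (by linarith)
  have hXY : ‖(p : ℂ) ^ (-(z + a + d)) * (p : ℂ) ^ (-(z + b + c))‖ ≤ (p : ℝ) ^ (-(1 + κ)) := by
    rw [norm_mul, norm_natCast_cpow_of_pos hp.pos, norm_natCast_cpow_of_pos hp.pos, neg_re,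
      neg_re, ← Real.rpow_add (by linarith)]
    exact Real.rpow_le_rpow_of_exponent_le h1 (by linarith)
  have hX := norm_one_sub_prime_cpow_inv_le hp (v := z + a + d) (by linarith)
  have hY := norm_one_sub_prime_cpow_inv_le hp (v := z + b + c) (by linarith)
  rw [rankinSelbergFactor, norm_mul, norm_mul]
  calc _ ≤ ((p : ℝ) ^ (-(1 + κ)) + (p : ℝ) ^ (-(1 + κ))) * (4 * 4) := by
        gcongr
        exact (norm_sub_le _ _).trans (add_le_add hW hXY)
    _ = _ := by push_cast; ring

theorem differentiableAt_rankinSelbergFactor {a b c d z : ℂ} (h₁ : 0 < (z + a + d).re)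
    (h₂ : 0 < (z + b + c).re) {p : ℕ} (hp : p.Prime) :
    DifferentiableAt ℂ (fun z => rankinSelbergFactor a b c d z p) z := by
  have hp0 : (p : ℂ) ≠ 0 := Nat.cast_ne_zero.mpr hp.ne_zero
  have h : ∀ x y : ℂ, DifferentiableAt ℂ (fun z => (p : ℂ) ^ (-(z + x + y))) z := fun x y =>
    DifferentiableAt.const_cpow (by fun_prop) (.inl hp0)
  exact ((h c d).sub ((h a d).mul (h b c))).mul
    ((((differentiableAt_const 1).sub (h a d)).inv (one_sub_prime_cpow_ne_zero hp h₁)).mul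
      (((differentiableAt_const 1).sub (h b c)).inv (one_sub_prime_cpow_ne_zero hp h₂)))

/-- The meromorphic continuation of `𝓑_{a,b,c,d}`. -/
noncomputable def rankinSelbergContinuation (a b c d z : ℂ) : ℂ :=
  riemannZeta (z + a + b) * trivLInv 1 (z + a + d) * trivLInv 1 (z + b + c) *
    ∑' q, squarefreeProd (rankinSelbergFactor a b c d z) q

theorem rankinSelbergContinuation_eq_lSeries {a b c d z : ℂ}
    (h₁ : 1 < (z + a + b).re) (h₂ : 1 < (z + a + d).re) (h₃ : 1 < (z + b + c).re)
    (h₄ : 1 < (z + c + d).re)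
    (hs : LSeriesSummable (fun n => ratioCoeff a c n * ratioCoeff b d n) z) :
    rankinSelbergContinuation a b c d z =
      LSeries (fun n => ratioCoeff a c n * ratioCoeff b d n) z := by
  obtain ⟨κ, hκ, hκ1, hκ2⟩ : ∃ κ : ℝ, 0 < κ ∧ κ ≤ 1 / 2 ∧ 1 + κ ≤ (z + c + d).re :=
    ⟨min (1 / 2) ((z + c + d).re - 1), lt_min (by norm_num) (by linarith), min_le_left _ _, by
      linarith [min_le_right (1 / 2 : ℝ) ((z + c + d).re - 1)]⟩
  have hsum : Summable fun q => ‖squarefreeProd (rankinSelbergFactor a b c d z) q‖ :=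
    (summable_squarefreeBound 32 (x := 1 + κ) (by linarith)).of_nonneg_of_le
      (fun _ => norm_nonneg _) (norm_squarefreeProd_le fun p hp =>
        norm_rankinSelbergFactor_le (by linarith) (by linarith) hκ2 hκ hp)
  have e1 := (riemannZeta_eulerProduct_hasProd h₁).mul
    (hasProd_one_add_of_summable_squarefreeProd hsum)
  have e2 := ((hasProd_lSeries_of_coprime (by simp [ratioCoeff_one])
    (fun {m n} hmn => by rw [ratioCoeff_mul a c hmn, ratioCoeff_mul b d hmn]; ring) hs).mul
    (riemannZeta_eulerProduct_hasProd h₂)).mul (riemannZeta_eulerProduct_hasProd h₃)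
  -- The identity is cross-multiplied by the two zeta factors of the denominator, so that both sides
  -- are convergent products and uniqueness of `HasProd` applies.
  have hfac : ∀ p : Nat.Primes,
      (1 - (p : ℂ) ^ (-(z + a + b)))⁻¹ * (1 + rankinSelbergFactor a b c d z p) =
      (∑' e : ℕ, LSeries.term (fun n => ratioCoeff a c n * ratioCoeff b d n) z (p ^ e)) *
        (1 - (p : ℂ) ^ (-(z + a + d)))⁻¹ * (1 - (p : ℂ) ^ (-(z + b + c)))⁻¹ := by
    intro p
    have hX := one_sub_prime_cpow_ne_zero p.prop (v := z + a + d) (by linarith)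
    have hY := one_sub_prime_cpow_ne_zero p.prop (v := z + b + c) (by linarith)
    rw [tsum_term_ratioCoeff_mul a b c d p.prop (by linarith), rankinSelbergFactor]
    rw [mul_assoc, mul_assoc]
    congr 1
    field_simp
    ring
  simp only [hfac] at e1
  have key := e1.unique e2
  have hne : ∀ v : ℂ, 1 < v.re → trivLInv 1 v = (riemannZeta v)⁻¹ := fun v hv => by
    rw [trivLInv_of_ne 1 (by rintro rfl; simp at hv), DirichletCharacter.LFunctionTrivChar,
      DirichletCharacter.LFunction_modOne_eq]
  have hz2 := riemannZeta_ne_zero_of_one_le_re h₂.le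
  have hz3 := riemannZeta_ne_zero_of_one_le_re h₃.le
  rw [rankinSelbergContinuation, hne _ h₂, hne _ h₃]
  field_simp
  linear_combination key

theorem GeneralizedRiemannHypothesis.continuesTo_rankinSelberg
    (hGRH : GeneralizedRiemannHypothesis) {a b c d z : ℂ} (h₁ : z + a + b ≠ 1)
    (h₂ : 1 / 2 < (z + a + d).re) (h₃ : 1 / 2 < (z + b + c).re) (h₄ : 1 < (z + c + d).re) :
    ContinuesTo (fun n => ratioCoeff a c n * ratioCoeff b d n) z
      (rankinSelbergContinuation a b c d) ∧
    Summable (squarefreeProd (rankinSelbergFactor a b c d z)) := by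
  -- Half of the available margin is spent on moving left to `Re w > Re z - κ`; the other half keeps
  -- the majorant in `q` uniform there.
  obtain ⟨κ, hκ, k2, k3, k4⟩ : ∃ κ : ℝ, 0 < κ ∧ 1 / 2 + 2 * κ ≤ (z + a + d).re ∧
      1 / 2 + 2 * κ ≤ (z + b + c).re ∧ 1 + 2 * κ ≤ (z + c + d).re := by
    set m := min (min ((z + a + d).re - 1 / 2) ((z + b + c).re - 1 / 2)) ((z + c + d).re - 1)
      with hm
    have hm0 : 0 < m := lt_min (lt_min (by linarith) (by linarith)) (by linarith)
    have m1 : m ≤ (z + a + d).re - 1 / 2 := (min_le_left _ _).trans (min_le_left _ _)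
    have m2 : m ≤ (z + b + c).re - 1 / 2 := (min_le_left _ _).trans (min_le_right _ _)
    have m3 : m ≤ (z + c + d).re - 1 := min_le_right _ _
    exact ⟨m / 2, by linarith, by linarith, by linarith, by linarith⟩
  set Ω : Set ℂ := {w | z.re - κ < w.re} with hΩ
  have hΩo : IsOpen Ω := isOpen_lt continuous_const continuous_re
  have hzΩ : z ∈ Ω := by simp [hΩ, hκ]
  simp only [add_re] at k2 k3 k4
  have w2 : ∀ w ∈ Ω, 1 / 2 + κ ≤ (w + a + d).re := fun w hw => by
    simp only [add_re, hΩ, Set.mem_ofPred_eq] at hw ⊢; linarith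
  have w3 : ∀ w ∈ Ω, 1 / 2 + κ ≤ (w + b + c).re := fun w hw => by
    simp only [add_re, hΩ, Set.mem_ofPred_eq] at hw ⊢; linarith
  have w4 : ∀ w ∈ Ω, 1 + κ ≤ (w + c + d).re := fun w hw => by
    simp only [add_re, hΩ, Set.mem_ofPred_eq] at hw ⊢; linarith
  have hbound := summable_squarefreeBound 32 (x := 1 + κ) (by linarith)
  have hle : ∀ q : ℕ, ∀ w ∈ Ω, ‖squarefreeProd (rankinSelbergFactor a b c d w) q‖ ≤
      squarefreeBound 32 (1 + κ) q := fun q w hw => norm_squarefreeProd_le (fun p hp =>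
        norm_rankinSelbergFactor_le (w2 w hw) (w3 w hw) (w4 w hw) hκ hp) q
  have hdiff : DifferentiableOn ℂ
      (fun w => ∑' q, squarefreeProd (rankinSelbergFactor a b c d w) q) Ω := by
    refine differentiableOn_tsum_of_summable_norm hbound (fun q => ?_) hΩo hle
    by_cases hq : Squarefree q
    · simp only [squarefreeProd, if_pos hq]
      refine DifferentiableOn.fun_finsetProd fun p hp => fun w hw => ?_
      exact (differentiableAt_rankinSelbergFactor (by linarith [w2 w hw]) (by linarith [w3 w hw])
        (Nat.prime_of_mem_primeFactors hp)).differentiableWithinAt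
    · simp only [squarefreeProd, if_neg hq]
      exact differentiableOn_const 0
  have hinv : ∀ x y : ℂ, (∀ w ∈ Ω, 1 / 2 + κ ≤ (w + x + y).re) →
      DifferentiableOn ℂ (fun w => trivLInv 1 (w + x + y)) Ω := fun x y h =>
    (hGRH.differentiableOn_trivLInv 1).comp (f := fun w => w + x + y) (by fun_prop)
      fun w hw => by
        have := h w hw
        simp only [Set.mem_ofPred_eq]
        linarith
  have hrest : AnalyticOnNhd ℂ (fun w => trivLInv 1 (w + a + d) * trivLInv 1 (w + b + c) *
      ∑' q, squarefreeProd (rankinSelbergFactor a b c d w) q) Ω :=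
    (((hinv a d w2).mul (hinv b c w3)).mul hdiff).analyticOnNhd hΩo
  have hform : rankinSelbergContinuation a b c d = fun w => riemannZeta (w + a + b) *
      (trivLInv 1 (w + a + d) * trivLInv 1 (w + b + c) *
      ∑' q, squarefreeProd (rankinSelbergFactor a b c d w) q) := by
    ext w
    rw [rankinSelbergContinuation]
    ring
  refine ⟨⟨?_, z.re - κ, by linarith, ?_,
    3 + ‖a‖ + ‖b‖ + ‖c‖ + ‖d‖ + |z.re|, fun w hw => ?_⟩,
    .of_norm_bounded hbound fun q => hle q z hzΩ⟩
  · rw [hform]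
    refine AnalyticAt.mul ?_ (hrest z hzΩ)
    have hd : DifferentiableOn ℂ (fun w => riemannZeta (w + a + b)) {w | w + a + b ≠ 1} :=
      fun w hw => ((differentiableAt_riemannZeta hw).comp (f := fun w => w + a + b) w
        (by fun_prop)).differentiableWithinAt
    exact hd.analyticAt ((isOpen_ne.preimage (by fun_prop)).mem_nhds h₁)
  · rw [hform]
    intro w hw
    refine MeromorphicAt.mul ?_ (hrest w hw).meromorphicAt
    exact (meromorphicAt_riemannZeta _).comp_analyticAt (f := riemannZeta)
      (g := fun w => w + a + b) (by fun_prop)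
  · have n1 := abs_nonneg z.re
    have hsum := lSeriesSummable_ratioCoeff_mul a b c d (z := w) (by linarith)
    have ha := (abs_le.mp (abs_re_le_norm a)).1
    have hb := (abs_le.mp (abs_re_le_norm b)).1
    have hc := (abs_le.mp (abs_re_le_norm c)).1
    have hd := (abs_le.mp (abs_re_le_norm d)).1
    have na := norm_nonneg a
    have nb := norm_nonneg b
    have nc := norm_nonneg c
    have nd := norm_nonneg d
    refine ⟨hsum, rankinSelbergContinuation_eq_lSeries ?_ ?_ ?_ ?_ hsum⟩ <;>
    · rw [add_re, add_re]
      linarith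

/-! ### Residue evaluation, comparison of local factors and conclusion. -/

theorem re_mem_Icc_of_mem_closedBall_one {w : ℂ} {ε : ℝ} (hw : w ∈ closedBall (1 : ℂ) ε) :
    1 - ε ≤ w.re ∧ w.re ≤ 1 + ε := by
  rw [mem_closedBall, dist_eq] at hw
  have := abs_le.mp ((abs_re_le_norm (w - 1)).trans hw)
  rw [sub_re, one_re] at this
  constructor <;> linarith

theorem one_sub_mem_ball {α : ℂ} {ε : ℝ} (h : ‖α‖ < ε) : 1 - α ∈ ball (1 : ℂ) ε := by
  simpa [mem_ball, dist_eq] using h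

theorem continuesTo_twistedCoeff_of_mem_sphere
    {α γ : ℂ} {ε : ℝ} (hα : ‖α‖ < ε) (hεγ : 1 / 2 < 1 - ε + γ.re) {q : ℕ} {P : ℂ → ℂ}
    (hP : ∀ w : ℂ, 1 / 2 < (w + γ).re → w ≠ 1 - α →
      ContinuesTo (twistedCoeff α γ q) w (fun w => P w / (w - (1 - α)))) {w : ℂ}
    (hw : w ∈ sphere (1 : ℂ) ε) :
    ContinuesTo (twistedCoeff α γ q) w (fun w => P w / (w - (1 - α))) := by
  refine hP w ?_ ?_
  · rw [add_re]
    linarith [(re_mem_Icc_of_mem_closedBall_one (sphere_subset_closedBall hw)).1]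
  · rintro rfl
    exact (mem_ball.mp (one_sub_mem_ball hα)).ne (mem_sphere.mp hw)

theorem GeneralizedRiemannHypothesis.contourTerm_eq_residue
    (hGRH : GeneralizedRiemannHypothesis) {α β γ δ : ℂ} {ε : ℝ}
    (hα : ‖α‖ < ε) (hβ : ‖β‖ < ε) (hεγ : 1 / 2 < 1 - ε + γ.re) (hεδ : 1 / 2 < 1 - ε + δ.re)
    {s : ℂ} (hs : 1 + 2 * ε < s.re) (q : ℕ) [NeZero q] :
    contourTerm α β γ δ ε s q = zetaChi (1 - (s + α + β)) *
      LSeries (ramanujanSum q) (s + α + β) * twistedResidue α γ q * twistedResidue β δ q := by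
  have hq : q ≠ 0 := NeZero.ne q
  obtain ⟨P₁, hP₁d, hP₁r, hP₁c⟩ := hGRH.exists_twisted_continuation α γ q
  obtain ⟨P₂, hP₂d, hP₂r, hP₂c⟩ := hGRH.exists_twisted_continuation β δ q
  have hsub : ∀ {η : ℂ}, 1 / 2 < 1 - ε + η.re →
      closedBall (1 : ℂ) ε ⊆ {w | 1 / 2 < (w + η).re} := fun {η} h w hw => by
    simp only [Set.mem_ofPred_eq, add_re]
    linarith [(re_mem_Icc_of_mem_closedBall_one hw).1]
  -- On `Re v < Re s + 1` the series over `h` converges absolutely and `zetaChi` is evaluated away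
  -- from the poles of its Gamma factor. As `Re (w + z) ≤ 2 + 2ε < Re s + 1` on the closed discs,
  -- this domain suffices.
  have hG : DifferentiableOn ℂ
      (fun v => zetaChi (v - s - 1) * LSeries (ramanujanSum q) (s + 2 - v))
      {v | v.re < s.re + 1} := by
    refine DifferentiableOn.mul (fun v hv => ?_)
      ((differentiableOn_lSeries_ramanujanSum hq).comp (f := fun v => s + 2 - v) (by fun_prop)
        fun v hv => ?_)
    · refine ((differentiableAt_zetaChi ?_).comp (f := fun v => v - s - 1) v
        (by fun_prop)).differentiableWithinAt
      simp only [Set.mem_ofPred_eq, sub_re, one_re] at hv ⊢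
      linarith
    · simp only [Set.mem_ofPred_eq, sub_re, add_re, re_ofNat] at hv ⊢
      linarith
  have h := circleIntegral_circleIntegral_eq
    (G := fun v => zetaChi (v - s - 1) * LSeries (ramanujanSum q) (s + 2 - v))
    (F₁ := dirichletValue (twistedCoeff α γ q)) (F₂ := dirichletValue (twistedCoeff β δ q))
    (one_sub_mem_ball hα) (one_sub_mem_ball hβ)
    (hsub hεγ) (hsub hεδ)
    (fun w hw z hz => by
      simp only [Set.mem_ofPred_eq, add_re]
      linarith [(re_mem_Icc_of_mem_closedBall_one hw).2,
        (re_mem_Icc_of_mem_closedBall_one hz).2])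
    hP₁d hP₂d hG
    (fun w hw => dirichletValue_eq (continuesTo_twistedCoeff_of_mem_sphere hα hεγ hP₁c hw))
    (fun w hw => dirichletValue_eq (continuesTo_twistedCoeff_of_mem_sphere hβ hεδ hP₂c hw))
  have hpi : (2 * Real.pi * I : ℂ) ^ 2 ≠ 0 := pow_ne_zero 2 (by simp [Real.pi_ne_zero])
  rw [contourTerm]
  simp only [sub_sub (s + 2)]
  refine (congrArg _ h).trans ?_
  rw [hP₁r, hP₂r, one_div, inv_mul_cancel_left₀ hpi]
  rw [show 1 - α + (1 - β) - s - 1 = 1 - (s + α + β) by ring,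
    show s + 2 - (1 - α + (1 - β)) = s + α + β by ring]

/-- The prefactor is independent of `q` and is the one in `rankinSelbergContinuation`, so summing
over `q` gives the continued series at once. -/
theorem mul_twistedResidue_eq_squarefreeProd {α β γ δ s : ℂ} (hu : 1 < (s + α + β).re)
    (q : ℕ) [NeZero q] :
    zetaChi (1 - (s + α + β)) * LSeries (ramanujanSum q) (s + α + β) *
      twistedResidue α γ q * twistedResidue β δ q =
    riemannZeta (1 + -β + (-α - s)) * trivLInv 1 (1 + -β + δ) *
      trivLInv 1 (1 + (-α - s) + (γ + s)) *
      squarefreeProd (rankinSelbergFactor (-β) (-α - s) (γ + s) δ 1) q := by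
  have hq : q ≠ 0 := NeZero.ne q
  rw [(lSeriesHasSum_ramanujanSum hq hu).LSeries_eq, ← mul_assoc,
    zetaChi_one_sub_mul_riemannZeta hu]
  by_cases hsq : Squarefree q
  · have hμ : (ArithmeticFunction.moebius q : ℂ) * ArithmeticFunction.moebius q = 1 := by
      rw [← pow_two]
      exact_mod_cast ArithmeticFunction.moebius_sq_eq_one_of_squarefree hsq
    rw [twistedResidue, twistedResidue, trivLInv_eq_prod q (1 - α + γ),
      trivLInv_eq_prod q (1 - β + δ), sum_divisors_moebius_mul_cpow hsq,
      natCast_cpow_eq_prod_primeFactors hsq, natCast_cpow_eq_prod_primeFactors hsq,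
      squarefreeProd, if_pos hsq]
    have hprod : ∏ p ∈ q.primeFactors, rankinSelbergFactor (-β) (-α - s) (γ + s) δ 1 p =
        (∏ p ∈ q.primeFactors, ((p : ℂ) ^ (1 - (s + α + β)) - 1)) *
        (∏ p ∈ q.primeFactors, (p : ℂ) ^ (-(1 - α + γ))) *
        (∏ p ∈ q.primeFactors, (p : ℂ) ^ (-(1 - β + δ))) *
        (∏ p ∈ q.primeFactors, (1 - (p : ℂ) ^ (-(1 - α + γ)))⁻¹) *
        (∏ p ∈ q.primeFactors, (1 - (p : ℂ) ^ (-(1 - β + δ)))⁻¹) := by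
      simp only [← Finset.prod_mul_distrib]
      refine Finset.prod_congr rfl fun p hp => ?_
      have hp0 : (p : ℂ) ≠ 0 := Nat.cast_ne_zero.mpr (Nat.prime_of_mem_primeFactors hp).ne_zero
      -- This is `W = p^{1-u} XY`, the relation that makes the two local factors coincide.
      have e1 : (p : ℂ) ^ (-(1 + (γ + s) + δ)) = (p : ℂ) ^ (1 - (s + α + β)) *
          (p : ℂ) ^ (-(1 - α + γ)) * (p : ℂ) ^ (-(1 - β + δ)) := by
        rw [← cpow_add _ _ hp0, ← cpow_add _ _ hp0]
        ring_nf
      rw [rankinSelbergFactor, e1, show 1 + -β + δ = 1 - β + δ by ring,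
        show 1 + (-α - s) + (γ + s) = 1 - α + γ by ring]
      ring
    rw [hprod, show 1 + -β + (-α - s) = 1 - (s + α + β) by ring,
      show 1 + -β + δ = 1 - β + δ by ring, show 1 + (-α - s) + (γ + s) = 1 - α + γ by ring]
    linear_combination (riemannZeta (1 - (s + α + β)) * trivLInv 1 (1 - β + δ) *
      trivLInv 1 (1 - α + γ) * ((∏ p ∈ q.primeFactors, ((p : ℂ) ^ (1 - (s + α + β)) - 1)) *
        (∏ p ∈ q.primeFactors, (p : ℂ) ^ (-(1 - α + γ))) *
        (∏ p ∈ q.primeFactors, (p : ℂ) ^ (-(1 - β + δ))) *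
        (∏ p ∈ q.primeFactors, (1 - (p : ℂ) ^ (-(1 - α + γ)))⁻¹) *
        (∏ p ∈ q.primeFactors, (1 - (p : ℂ) ^ (-(1 - β + δ)))⁻¹))) * hμ
  · simp [twistedResidue, squarefreeProd, hsq]

theorem theorem1 (hGRH : GeneralizedRiemannHypothesis)
    (α β γ δ : ℂ) (ε : ℝ)
    (hα : ‖α‖ < ε) (hβ : ‖β‖ < ε) (hγ : ‖γ‖ < ε) (hδ : ‖δ‖ < ε) (hε : ε < 1 / 2)
    (hεγ : 1 / 2 < 1 - ε + γ.re) (hεδ : 1 / 2 < 1 - ε + δ.re)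
    (s : ℂ) (hs : 1 + 2 * ε < s.re) :
    (∀ q : ℕ, 1 ≤ q → ∀ w ∈ sphere (1 : ℂ) ε,
      IsRegularAt (twistedCoeff α γ q) w ∧ IsRegularAt (twistedCoeff β δ q) w) ∧
    (∀ q : ℕ, 1 ≤ q → ∀ w ∈ sphere (1 : ℂ) ε, ∀ z ∈ sphere (1 : ℂ) ε,
      LSeriesSummable (ramanujanSum q) (s + 2 - w - z)) ∧
    IsRegularAt (fun n => ratioCoeff (-β) (γ + s) n * ratioCoeff (-α - s) δ n) 1 ∧
    HasSum (fun q : ℕ+ => contourTerm α β γ δ ε s q)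
      (rankinSelberg (-β) (-α - s) (γ + s) δ 1) := by
  have hα' := abs_le.mp ((abs_re_le_norm α).trans hα.le)
  have hβ' := abs_le.mp ((abs_re_le_norm β).trans hβ.le)
  have hu : 1 < (s + α + β).re := by
    rw [add_re, add_re]
    linarith
  -- The argument of `ζ` is `1 - u`, of negative real part and so away from the pole. The two
  -- reciprocal zetas sit at `1 - β + δ` and `1 - α + γ`, to the right of `1/2` by `hεδ` and `hεγ`.
  have hRS := hGRH.continuesTo_rankinSelberg (a := -β) (b := -α - s) (c := γ + s) (d := δ)
    (z := 1) (fun h => by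
      have := congrArg re h
      simp only [add_re, sub_re, neg_re, one_re] at this hu
      linarith) (by simp only [add_re, neg_re, one_re]; linarith)
    (by simp only [add_re, sub_re, neg_re, one_re]; linarith)
    (by
      have hγ' := abs_le.mp ((abs_re_le_norm γ).trans hγ.le)
      have hδ' := abs_le.mp ((abs_re_le_norm δ).trans hδ.le)
      simp only [add_re, one_re]
      linarith)
  refine ⟨fun q hq w hw => ?_, fun q hq w hw z hz => ?_, ⟨_, hRS.1⟩, ?_⟩
  · have : NeZero q := ⟨by omega⟩
    obtain ⟨P₁, -, -, hP₁⟩ := hGRH.exists_twisted_continuation α γ q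
    obtain ⟨P₂, -, -, hP₂⟩ := hGRH.exists_twisted_continuation β δ q
    exact ⟨⟨_, continuesTo_twistedCoeff_of_mem_sphere hα hεγ hP₁ hw⟩,
      ⟨_, continuesTo_twistedCoeff_of_mem_sphere hβ hεδ hP₂ hw⟩⟩
  · refine lSeriesSummable_ramanujanSum (by omega) ?_
    simp only [sub_re, add_re, re_ofNat]
    linarith [(re_mem_Icc_of_mem_closedBall_one (sphere_subset_closedBall hw)).2,
      (re_mem_Icc_of_mem_closedBall_one (sphere_subset_closedBall hz)).2]
  · rw [rankinSelberg, dirichletValue_eq hRS.1, rankinSelbergContinuation]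
    have h1 := hRS.2.hasSum
    -- Passing from `ℕ` to `ℕ+` loses nothing, since `0` is not squarefree and its term vanishes.
    rw [← PNat.coe_injective.hasSum_iff (fun n hn => ?_)] at h1
    · refine (h1.mul_left _).congr_fun fun q => ?_
      have : NeZero (q : ℕ) := ⟨q.ne_zero⟩
      rw [hGRH.contourTerm_eq_residue hα hβ hεγ hεδ hs,
        mul_twistedResidue_eq_squarefreeProd hu]
      rfl
    · have : n = 0 := by
        by_contra h0
        exact hn ⟨⟨n, Nat.pos_of_ne_zero h0⟩, rfl⟩
      rw [this, squarefreeProd_zero]
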